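/- Let $n,m\ge 1$ and let $\Lambda^{(1)},\dots,\Lambda^{(m)}$ be linearly independent skew-symmetric real $n\times n$ matrices. Consider the step-two Carnot group $\mathbb G=\mathbb R^{n}\times\mathbb R^m$ with the group law $(x,z)\circ(x',z')=\bigl(x+x',\,(z_j+z_j'+\tfrac12\langle\Lambda^{(j)}x,x'\rangle)_{j=1,\dots,m}\bigr)$, the horizontal sub-gradient $\nabla=(X_1,\dots,X_n)$, where $X_i=\frac{\partial}{\partial x_i}+\frac12\sum_{k=1}^m\sum_{l=1}^n\Lambda^{(k)}_{il}x_l\frac{\partial}{\partial z_k}$, and the homogeneous norm $N(x,z)=(|x|^4+a|z|^2)^{1/4}$ with $a\in(0,\infty)$. Let $g:[0,\infty)\to[0,\infty)$ be an increasing (not necessarily strictly) differentiable function whose derivative $g'$ is differentiable on $[1,\infty)$ with $g''(t)\le g'(t)^3t^3$ for all $t\ge1$ (at $t=1$, $g''$ is the right derivative of $g'$). Let $\lambda$ be Lebesgue measure on $\mathbb R^{n+m}$, and assume that $d\mu=\frac1Z e^{-g(N)}\,d\lambda$, with $Z=\int e^{-g(N)}\,d\lambda$, is a probability measure (that is, $Z<\infty$).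 Then for every real $q\ge2$ there are constants $C,D\in(0,\infty)$ such that $$\int\frac{g'(N)}{N^2}|f|^q\,d\mu\le C\int|\nabla f|^q\,d\mu+D\int|f|^q\,d\mu$$ for every function $f:\mathbb G\to\mathbb R$ that vanishes on $\{N<1\}$ and is locally Lipschitz with respect to the Carnot–Carathéodory distance (equivalently, with respect to the homogeneous distance $N(p^{-1}\circ p')$; this includes all functions that are locally Lipschitz in the Euclidean sense). The integrals take values in $[0,\infty]$, and the constants do not depend on $f$. -/

import Mathlib

open MeasureTheory

/-- The data of a step-two Carnot group on `ℝⁿ × ℝᵐ`: skew-symmetric, linearly independent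
`n × n` matrices `Λ⁽¹⁾, …, Λ⁽ᵐ⁾`, with `m ≥ 1`. -/
structure StepTwoCarnot (n m : ℕ) where
  /-- the structure matrices -/
  Λ : Fin m → Matrix (Fin n) (Fin n) ℝ
  skew : ∀ j, (Λ j).transpose = -(Λ j)
  indep : LinearIndependent ℝ Λ
  pos : 0 < m

namespace StepTwoCarnot

/-- The underlying space `ℝⁿ × ℝᵐ`, each factor with its Euclidean norm. Its `volume` is
Lebesgue measure. -/
abbrev Space (n m : ℕ) : Type := EuclideanSpace ℝ (Fin n) × EuclideanSpace ℝ (Fin m)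

noncomputable section

variable {n m : ℕ}

/-- The group law `(x, z) ∘ (x', z') = (x + x', z_j + z'_j + ½ ⟨Λ⁽ʲ⁾ x, x'⟩)`. -/
def op (G : StepTwoCarnot n m) (p p' : Space n m) : Space n m :=
  (p.1 + p'.1,
    WithLp.toLp 2 fun j => p.2 j + p'.2 j + (1 / 2) * ∑ i, (∑ l, G.Λ j i l * p.1 l) * p'.1 i)

/-- The homogeneous norm `N(x, z) = (|x|⁴ + a |z|²)^{1/4}`. -/
def gauge (a : ℝ) (p : Space n m) : ℝ :=
  (‖p.1‖ ^ 4 + a * ‖p.2‖ ^ 2) ^ ((1 : ℝ) / 4)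

/-- The value at `p = (x, z)` of the left-invariant vector field
`X_i = ∂/∂x_i + ½ ∑_k ∑_l Λ⁽ᵏ⁾_{il} x_l ∂/∂z_k`. -/
def field (G : StepTwoCarnot n m) (i : Fin n) (p : Space n m) : Space n m :=
  (EuclideanSpace.single i 1, WithLp.toLp 2 fun k => (1 / 2) * ∑ l, G.Λ k i l * p.1 l)

/-- The integral curve of `X_i` through `p` is the straight line `s ↦ p ∘ (s e_i, 0)`; hence
`X_i f (p)` is the line derivative of `f` at `p` in the direction `G.field i p`. -/
theorem op_single (G : StepTwoCarnot n m) (i : Fin n) (p : Space n m) (s : ℝ) :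
    G.op p (EuclideanSpace.single i s, 0) = p + s • G.field i p := by
  ext j
  · simp [op, field]
  · simp [op, field]
    ring

/-- The horizontal sub-gradient `∇f = (X_1 f, …, X_n f)`. -/
def subgradient (G : StepTwoCarnot n m) (f : Space n m → ℝ) (p : Space n m) :
    EuclideanSpace ℝ (Fin n) :=
  WithLp.toLp 2 fun i => lineDeriv ℝ f p (G.field i p)

/-- `f` is locally Lipschitz on the group for the left-invariant homogeneous (quasi-)distance
`N(p⁻¹ ∘ p')`, where `p⁻¹ = -p`. That distance is bi-Lipschitz equivalent to the
Carnot–Carathéodory distance; functions that are locally Lipschitz for the Euclidean distance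
are locally Lipschitz in this sense. -/
def LocLipschitz (G : StepTwoCarnot n m) (a : ℝ) (f : Space n m → ℝ) : Prop :=
  ∀ p, ∃ K : ℝ, ∃ U ∈ nhds p, ∀ u ∈ U, ∀ v ∈ U, |f u - f v| ≤ K * gauge a (G.op (-u) v)

/-- The measure `dμ = Z⁻¹ e^{-g(N)} dλ` with `Z = ∫ e^{-g(N)} dλ`. (It is a probability measure
exactly if `e^{-g(N)}` is integrable.) -/
def gibbs (n m : ℕ) (a : ℝ) (g : ℝ → ℝ) : Measure (Space n m) :=
  volume.withDensity fun p =>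
    ENNReal.ofReal (Real.exp (-g (gauge a p)) / ∫ p' : Space n m, Real.exp (-g (gauge a p')))

end

end StepTwoCarnot

open Filter Metric Topology in
/-- `F` is locally Lipschitz along the lines `s ↦ q + s • w q`. -/
def LocLipAlong {E : Type*} [NormedAddCommGroup E] [NormedSpace ℝ E] (w : E → E) (F : E → ℝ) :
    Prop :=
  ∀ p, ∃ K : ℝ, ∃ U ∈ 𝓝 p, ∀ q ∈ U, ∀ s : ℝ, q + s • w q ∈ U →
    |F (q + s • w q) - F q| ≤ K * |s|

section LineIntegration

open Filter Metric Topology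

theorem LocallyLipschitz.ae_differentiableAt_of_real {φ : ℝ → ℝ} (hφ : LocallyLipschitz φ) :
    ∀ᵐ t, DifferentiableAt ℝ φ t := by
  have h : ∀ N : ℕ, ∀ᵐ t, t ∈ Set.Icc (-(N : ℝ)) N → DifferentiableWithinAt ℝ φ
      (Set.Icc (-(N : ℝ)) N) t := by
    intro N
    obtain ⟨K, hK⟩ := LocallyLipschitzOn.exists_lipschitzOnWith_of_compact isCompact_Icc
      (hφ.locallyLipschitzOn (s := Set.Icc (-(N : ℝ)) N))
    exact hK.ae_differentiableWithinAt_of_mem_real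
  filter_upwards [ae_all_iff.2 h] with t ht
  obtain ⟨N, hN⟩ := exists_nat_gt |t|
  have h2 := abs_lt.1 hN
  exact (ht N ⟨h2.1.le, h2.2.le⟩).differentiableAt (Icc_mem_nhds h2.1 h2.2)

variable {E : Type*} [NormedAddCommGroup E] [NormedSpace ℝ E] {F F' : E → ℝ} {v : E} {w : E → E}

theorem LocLipAlong.locallyLipschitz_line (h : LocLipAlong (fun _ => v) F) (p : E) :
    LocallyLipschitz fun t : ℝ => F (p + t • v) := by
  intro t₀
  obtain ⟨K, U, hU, hK⟩ := h (p + t₀ • v)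
  refine ⟨K.toNNReal, (fun t : ℝ => p + t • v) ⁻¹' U,
    (Continuous.continuousAt (by fun_prop)).preimage_mem_nhds hU, ?_⟩
  refine LipschitzOnWith.of_dist_le_mul fun x hx y hy => ?_
  have key : y + (x - y) = x := by ring
  have e : p + y • v + (x - y) • v = p + x • v := by
    rw [add_assoc, ← add_smul, key]
  have := hK _ hy (x - y) (by rw [e]; exact hx)
  rw [e] at this
  rw [Real.dist_eq, Real.dist_eq]
  exact this.trans (mul_le_mul_of_nonneg_right (Real.le_coe_toNNReal K) (abs_nonneg _))

theorem LocLipAlong.mul (hF : LocLipAlong w F) (hF' : LocLipAlong w F') (cF : Continuous F)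
    (cF' : Continuous F') : LocLipAlong w fun p => F p * F' p := by
  intro p
  obtain ⟨K, U, hU, hK⟩ := hF p
  obtain ⟨K', U', hU', hK'⟩ := hF' p
  refine ⟨(|F p| + 1) * K' + (|F' p| + 1) * K, U ∩ U' ∩ ({q | |F q| < |F p| + 1} ∩
    {q | |F' q| < |F' p| + 1}), inter_mem (inter_mem hU hU') (inter_mem
      ((isOpen_lt (by fun_prop) (by fun_prop)).mem_nhds (by simp))
      ((isOpen_lt (by fun_prop) (by fun_prop)).mem_nhds (by simp))), ?_⟩
  rintro q ⟨⟨h1, h2⟩, h3, h4⟩ s ⟨⟨h1', h2'⟩, h3', h4'⟩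
  have a1 := hK q h1 s h1'
  have a2 := hK' q h2 s h2'
  simp only [Set.mem_ofPred_eq] at h3 h4 h3' h4'
  have e : F (q + s • w q) * F' (q + s • w q) - F q * F' q =
    F (q + s • w q) * (F' (q + s • w q) - F' q) + F' q * (F (q + s • w q) - F q) := by ring
  rw [e]
  refine (abs_add_le _ _).trans ?_
  rw [abs_mul, abs_mul, add_mul, mul_assoc, mul_assoc]
  gcongr

theorem LocLipAlong.comp (hF : LocLipAlong w F) (cF : Continuous F) {φ : ℝ → ℝ}
    (hφ : LocallyLipschitz φ) : LocLipAlong w fun p => φ (F p) := by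
  intro p
  obtain ⟨K, U, hU, hK⟩ := hF p
  obtain ⟨C, T, hT, hC⟩ := hφ (F p)
  refine ⟨C * K, U ∩ F ⁻¹' T, inter_mem hU (cF.continuousAt.preimage_mem_nhds hT), ?_⟩
  rintro q ⟨h1, h2⟩ s ⟨h3, h4⟩
  have := hC.dist_le_mul _ h4 _ h2
  rw [Real.dist_eq, Real.dist_eq] at this
  rw [mul_assoc]
  exact this.trans (by gcongr; exact hK q h1 s h3)

theorem LocLipAlong.uniform_on_compact (h : LocLipAlong (fun _ => v) F) {S : Set E}
    (hS : IsCompact S) : ∃ K : ℝ, ∃ r > 0, ∀ x ∈ S, ∀ t : ℝ, |t| ≤ r →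
      |F (x + t • v) - F x| ≤ K * |t| := by
  refine hS.induction_on ⟨0, 1, one_pos, by simp⟩ ?_ ?_ ?_
  · rintro s t hst ⟨K, r, hr, h⟩
    exact ⟨K, r, hr, fun x hx => h x (hst hx)⟩
  · rintro s t ⟨K, r, hr, h⟩ ⟨K', r', hr', h'⟩
    refine ⟨max K K', min r r', lt_min hr hr', ?_⟩
    rintro x (hx | hx) t ht
    · exact (h x hx t (ht.trans (min_le_left _ _))).trans (by gcongr; exact le_max_left _ _)
    · exact (h' x hx t (ht.trans (min_le_right _ _))).trans (by gcongr; exact le_max_right _ _)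
  · intro p hp
    obtain ⟨K, U, hU, hK⟩ := h p
    obtain ⟨r, hr, hrU⟩ := Metric.mem_nhds_iff.1 hU
    refine ⟨ball p (r / 2), mem_nhdsWithin_of_mem_nhds (ball_mem_nhds _ (by positivity)), K,
      r / (2 * (‖v‖ + 1)), by positivity, fun x hx t ht => hK x (hrU (ball_subset_ball
        (by linarith) hx)) t (hrU ?_)⟩
    rw [mem_ball] at hx ⊢
    have h1 : dist (x + t • v) x ≤ r / 2 := by
      rw [dist_eq_norm, add_sub_cancel_left, norm_smul, Real.norm_eq_abs]
      calc |t| * ‖v‖ ≤ r / (2 * (‖v‖ + 1)) * (‖v‖ + 1) := by gcongr; linarith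
        _ = r / 2 := by field_simp
    linarith [dist_triangle (x + t • v) x p]

variable [FiniteDimensional ℝ E] [MeasurableSpace E] [BorelSpace E] {μ : Measure E}
  [μ.IsAddHaarMeasure]

theorem LocLipAlong.ae_lineDifferentiableAt (h : LocLipAlong (fun _ => v) F) (cF : Continuous F) :
    ∀ᵐ p ∂μ, LineDifferentiableAt ℝ F p v := by
  let L : ℝ →L[ℝ] E := ContinuousLinearMap.smulRight (1 : ℝ →L[ℝ] ℝ) v
  suffices A : ∀ p, ∀ᵐ (t : ℝ) ∂volume, LineDifferentiableAt ℝ F (p + t • v) v from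
    ae_mem_of_ae_add_linearMap_mem L.toLinearMap volume μ
      (measurableSet_lineDifferentiableAt cF) A
  intro p
  filter_upwards [(h.locallyLipschitz_line p).ae_differentiableAt_of_real] with s hs
  have h's : DifferentiableAt ℝ (fun t : ℝ ↦ F (p + t • v)) (s + 0) := by simpa using hs
  have : DifferentiableAt ℝ (fun t ↦ s + t) 0 := differentiableAt_id.const_add _
  simp only [LineDifferentiableAt]
  convert! h's.comp 0 this with _ t
  simp only [add_assoc, Function.comp_apply, add_smul]

theorem LocLipAlong.integral_lineDeriv_eq_zero (h : LocLipAlong (fun _ => v) F)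
    (cF : Continuous F) (sF : HasCompactSupport F) :
    Integrable (fun x => lineDeriv ℝ F x v) μ ∧ ∫ x, lineDeriv ℝ F x v ∂μ = 0 := by
  have hS : IsCompact (cthickening ‖v‖ (tsupport F)) := IsCompact.cthickening sF
  set S := cthickening ‖v‖ (tsupport F) with hSdef
  obtain ⟨K, r, hr, hK⟩ := h.uniform_on_compact hS
  have hbound : ∀ t : ℝ, 0 < t → t ≤ min r 1 → ∀ x,
      ‖t⁻¹ • (F (x + t • v) - F x)‖ ≤ S.indicator (fun _ => |K|) x := by
    intro t t_pos ht x
    by_cases hx : x ∈ S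
    · rw [Set.indicator_of_mem hx, norm_smul, Real.norm_eq_abs, Real.norm_eq_abs, abs_inv]
      rw [inv_mul_le_iff₀ (abs_pos.2 t_pos.ne')]
      refine (hK x hx t ?_).trans ?_
      · rw [abs_of_pos t_pos]; exact ht.trans (min_le_left _ _)
      · rw [mul_comm]; gcongr; exact le_abs_self K
    · have A : F x = 0 := by
        rw [← Function.notMem_support]
        contrapose hx
        exact self_subset_cthickening _ (subset_tsupport _ hx)
      have B : F (x + t • v) = 0 := by
        rw [← Function.notMem_support]
        contrapose hx
        apply mem_cthickening_of_dist_le _ _ (‖v‖) (tsupport F) (subset_tsupport _ hx)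
        simp only [dist_eq_norm, sub_add_cancel_left, norm_neg, norm_smul, Real.norm_eq_abs,
          abs_of_nonneg t_pos.le]
        exact mul_le_of_le_one_left (norm_nonneg v) (ht.trans (min_le_right _ _))
      simp [A, B, hx]
  have hlim : ∀ᵐ x ∂μ, Tendsto (fun t : ℝ => t⁻¹ • (F (x + t • v) - F x)) (𝓝[>] 0)
      (𝓝 (lineDeriv ℝ F x v)) := by
    filter_upwards [h.ae_lineDifferentiableAt cF] with x hx
    exact hx.hasLineDerivAt.tendsto_slope_zero_right
  have hev : ∀ᶠ t : ℝ in 𝓝[>] 0, 0 < t ∧ t ≤ min r 1 :=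
    Ioc_mem_nhdsGT (lt_min hr one_pos)
  have hint : Integrable (S.indicator fun _ => |K|) μ := by
    rw [integrable_indicator_iff hS.measurableSet]
    exact continuousOn_const.integrableOn_compact hS
  refine ⟨hint.mono' (aestronglyMeasurable_lineDeriv cF μ) ?_, ?_⟩
  · filter_upwards [hlim] with x hx
    exact le_of_tendsto hx.norm (hev.mono fun t ht => hbound t ht.1 ht.2 x)
  · have A : Tendsto (fun t : ℝ => ∫ x, t⁻¹ • (F (x + t • v) - F x) ∂μ) (𝓝[>] 0)
        (𝓝 (∫ x, lineDeriv ℝ F x v ∂μ)) := by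
      refine tendsto_integral_filter_of_dominated_convergence (S.indicator fun _ => |K|) ?_ ?_
        hint hlim
      · exact Eventually.of_forall fun t => Continuous.aestronglyMeasurable (by fun_prop)
      · exact hev.mono fun t ht => Eventually.of_forall (hbound t ht.1 ht.2)
    have Z : ∀ t : ℝ, ∫ x, t⁻¹ • (F (x + t • v) - F x) ∂μ = 0 := by
      intro t
      have i1 : Integrable F μ := cF.integrable_of_hasCompactSupport sF
      rw [integral_smul, integral_sub (i1.comp_add_right (t • v)) i1,
        integral_add_right_eq_self F (t • v), sub_self, smul_zero]
    simp only [Z] at A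
    exact tendsto_nhds_unique A tendsto_const_nhds |>.symm ▸ rfl

end LineIntegration

namespace StepTwoCarnot

open Filter Topology

variable {n m : ℕ} (G : StepTwoCarnot n m)

instance : (volume : Measure (Space n m)).IsAddHaarMeasure :=
  Measure.prod.instIsAddHaarMeasure volume volume

theorem skew_apply (k : Fin m) (i j : Fin n) : G.Λ k i j = -G.Λ k j i := by
  have := congrFun (congrFun (G.skew k) j) i
  simpa using this

theorem diag_eq_zero (k : Fin m) (i : Fin n) : G.Λ k i i = 0 := by
  linarith [G.skew_apply k i i]

theorem sum_add_smul_field (i : Fin n) (k : Fin m) (p q : Space n m) (s : ℝ) :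
    ∑ l, G.Λ k i l * (p + s • G.field i q).1 l = ∑ l, G.Λ k i l * p.1 l := by
  simp [field, mul_add, Finset.sum_add_distrib, G.diag_eq_zero]

theorem field_add_smul_field (i : Fin n) (p q : Space n m) (s : ℝ) :
    G.field i (p + s • G.field i q) = G.field i p := by
  unfold field
  simp only [Prod.mk.injEq, true_and]
  congr 1
  funext k
  exact congrArg _ (G.sum_add_smul_field i k p q s)

/-- A shear of the vertical directions which maps the lines in the direction of the `i`-th basis
vector to the integral curves of `X_i`. -/
noncomputable def straighten (i : Fin n) : Space n m ≃ₜ Space n m where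
  toFun p := (p.1, p.2 + WithLp.toLp 2 fun k => (1 / 2) * p.1 i * ∑ l, G.Λ k i l * p.1 l)
  invFun p := (p.1, p.2 - WithLp.toLp 2 fun k => (1 / 2) * p.1 i * ∑ l, G.Λ k i l * p.1 l)
  left_inv p := by simp
  right_inv p := by simp
  continuous_toFun := by fun_prop
  continuous_invFun := by fun_prop

theorem straighten_add (i : Fin n) (p : Space n m) (s : ℝ) :
    G.straighten i (p + s • (EuclideanSpace.single i 1, 0)) =
      G.straighten i p + s • G.field i (G.straighten i p) := by
  have h : ∀ k, ∑ l, G.Λ k i l * (p.1 + s • EuclideanSpace.single i (1 : ℝ)) l =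
      ∑ l, G.Λ k i l * p.1 l := fun k => by
    simp [mul_add, Finset.sum_add_distrib, G.diag_eq_zero]
  ext j
  · simp [straighten, field]
  · change (p.2 + s • (0 : EuclideanSpace ℝ (Fin m))) j +
        (1 / 2) * (p.1 + s • EuclideanSpace.single i (1 : ℝ)) i *
          ∑ l, G.Λ j i l * (p.1 + s • EuclideanSpace.single i (1 : ℝ)) l =
      p.2 j + (1 / 2) * p.1 i * (∑ l, G.Λ j i l * p.1 l) +
        s * ((1 / 2) * ∑ l, G.Λ j i l * p.1 l)
    rw [h]
    simp
    ring

theorem measurePreserving_straighten (i : Fin n) :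
    MeasurePreserving (G.straighten i) volume volume := by
  refine MeasurePreserving.skew_product (g := fun (x : EuclideanSpace ℝ (Fin n)) z =>
    z + WithLp.toLp 2 fun k =>
    (1 / 2) * x i * ∑ l, G.Λ k i l * x l) (MeasurePreserving.id volume) ?_ ?_
  · exact Continuous.measurable (by unfold Function.uncurry; fun_prop)
  · exact Eventually.of_forall fun x => map_add_right_eq_self _ _

variable {G} {F : Space n m → ℝ} {i : Fin n}

theorem locLipAlong_comp_straighten (hF : LocLipAlong (G.field i) F) :
    LocLipAlong (fun _ => (EuclideanSpace.single i 1, 0)) (F ∘ G.straighten i) := by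
  intro p
  obtain ⟨K, U, hU, hK⟩ := hF (G.straighten i p)
  refine ⟨K, G.straighten i ⁻¹' U,
    (G.straighten i).continuous.continuousAt.preimage_mem_nhds hU, fun q hq s hs => ?_⟩
  rw [Set.mem_preimage, straighten_add] at hs
  simpa only [Function.comp_apply, straighten_add] using hK _ hq s hs

theorem lineDifferentiableAt_comp_straighten (p : Space n m) :
    LineDifferentiableAt ℝ (F ∘ G.straighten i) p (EuclideanSpace.single i 1, 0) ↔
      LineDifferentiableAt ℝ F (G.straighten i p) (G.field i (G.straighten i p)) := by
  simp only [LineDifferentiableAt, Function.comp_apply, straighten_add]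

theorem lineDeriv_comp_straighten (p : Space n m) :
    lineDeriv ℝ (F ∘ G.straighten i) p (EuclideanSpace.single i 1, 0) =
      lineDeriv ℝ F (G.straighten i p) (G.field i (G.straighten i p)) := by
  simp only [lineDeriv, Function.comp_apply, straighten_add]

theorem ae_lineDifferentiableAt_field (hF : LocLipAlong (G.field i) F) (cF : Continuous F) :
    ∀ᵐ p, LineDifferentiableAt ℝ F p (G.field i p) := by
  have h := (locLipAlong_comp_straighten hF).ae_lineDifferentiableAt
    (μ := (volume : Measure (Space n m))) (cF.comp (G.straighten i).continuous)
  simp only [lineDifferentiableAt_comp_straighten] at h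
  have := ((G.measurePreserving_straighten i).symm
    (G.straighten i).toMeasurableEquiv).quasiMeasurePreserving.ae h
  filter_upwards [this] with p hp
  simpa using hp

theorem integral_lineDeriv_field (hF : LocLipAlong (G.field i) F) (cF : Continuous F)
    (sF : HasCompactSupport F) :
    Integrable (fun p => lineDeriv ℝ F p (G.field i p)) ∧
      ∫ p, lineDeriv ℝ F p (G.field i p) = 0 := by
  have h := (locLipAlong_comp_straighten hF).integral_lineDeriv_eq_zero
    (μ := (volume : Measure (Space n m))) (cF.comp (G.straighten i).continuous)
    (sF.comp_homeomorph (G.straighten i))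
  simp only [lineDeriv_comp_straighten] at h
  have mp := G.measurePreserving_straighten i
  have me := (G.straighten i).measurableEmbedding
  exact ⟨(mp.integrable_comp_emb me).1 h.1, (mp.integral_comp me
    fun p => lineDeriv ℝ F p (G.field i p)) ▸ h.2⟩

end StepTwoCarnot

namespace StepTwoCarnot

section HorizontalCalculus

open Filter Topology
open scoped Matrix

variable {n m : ℕ} (G : StepTwoCarnot n m) (a : ℝ)

/-- `Λ⁽ᵏ⁾ x`. -/
noncomputable def twist (k : Fin m) (p : Space n m) : Fin n → ℝ := G.Λ k *ᵥ p.1.ofLp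

/-- `Λ(z) = ∑ z_k Λ⁽ᵏ⁾`. -/
noncomputable def pencil (p : Space n m) : Matrix (Fin n) (Fin n) ℝ := ∑ k, p.2 k • G.Λ k

/-- `Λ(z) x`. -/
noncomputable def rot (p : Space n m) : Fin n → ℝ := G.pencil p *ᵥ p.1.ofLp

/-- `Λ(z)ᵀ Λ(z) x`. -/
noncomputable def rot2 (p : Space n m) : Fin n → ℝ := (G.pencil p)ᵀ *ᵥ G.rot p

/-- `|Λ(z) x|²`. -/
noncomputable def rotSq (p : Space n m) : ℝ := G.rot p ⬝ᵥ G.rot p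

/-- `|x|²`. -/
noncomputable def horSq (p : Space n m) : ℝ := p.1.ofLp ⬝ᵥ p.1.ofLp

/-- The fourth power of the gauge. -/
noncomputable def gaugeFour (p : Space n m) : ℝ := horSq p ^ 2 + a * (p.2.ofLp ⬝ᵥ p.2.ofLp)

/-- `X_i` applied to the `j`-th component of `Λ(z) x`. -/
noncomputable def dRot (i j : Fin n) (p : Space n m) : ℝ :=
  G.pencil p j i + (1 / 2) * ∑ k, G.twist k p i * G.twist k p j

/-- `X_i` applied to the `j`-th component of `Λ(z)ᵀ Λ(z) x`. -/
noncomputable def dRot2 (i j : Fin n) (p : Space n m) : ℝ :=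
  ∑ l, (((1 / 2) * ∑ k, G.twist k p i * G.Λ k l j) * G.rot p l + G.pencil p l j * G.dRot i l p)

/-- `X_i |Λ(z) x|²`. -/
noncomputable def dRotSq (i : Fin n) (p : Space n m) : ℝ :=
  2 * G.rot2 p i + ∑ k, G.twist k p i * (G.twist k p ⬝ᵥ G.rot p)

/-- `X_i N⁴`. -/
noncomputable def dGaugeFour (i : Fin n) (p : Space n m) : ℝ :=
  4 * horSq p * p.1 i + a * G.rot p i

variable {G a} {f g : Space n m → ℝ} {f' g' : ℝ} {p v : Space n m}

theorem pencil_apply (p : Space n m) (i j : Fin n) :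
    G.pencil p i j = ∑ k, p.2 k * G.Λ k i j := by
  simp [pencil, Matrix.sum_apply]

theorem pencil_skew (p : Space n m) : (G.pencil p)ᵀ = -G.pencil p := by
  ext i j
  simp only [Matrix.transpose_apply, Matrix.neg_apply, pencil_apply, ← Finset.sum_neg_distrib]
  exact Finset.sum_congr rfl fun k _ => by rw [G.skew_apply k j i]; ring

theorem rot_apply (p : Space n m) (i : Fin n) : G.rot p i = ∑ k, p.2 k * G.twist k p i := by
  simp only [rot, twist, pencil, Matrix.sum_mulVec, Matrix.smul_mulVec, Finset.sum_apply,
    Pi.smul_apply, smul_eq_mul]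

theorem hasLineDerivAt_mul (hf : HasLineDerivAt ℝ f f' p v) (hg : HasLineDerivAt ℝ g g' p v) :
    HasLineDerivAt ℝ (fun q => f q * g q) (f' * g p + f p * g') p v := by
  have h := HasDerivAt.mul hf hg
  simpa only [zero_smul, add_zero] using! h

theorem hasLineDerivAt_add (hf : HasLineDerivAt ℝ f f' p v) (hg : HasLineDerivAt ℝ g g' p v) :
    HasLineDerivAt ℝ (fun q => f q + g q) (f' + g') p v := by
  have h := HasDerivAt.add hf hg
  simpa only [zero_smul, add_zero] using! h

theorem hasLineDerivAt_sub (hf : HasLineDerivAt ℝ f f' p v) (hg : HasLineDerivAt ℝ g g' p v) :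
    HasLineDerivAt ℝ (fun q => f q - g q) (f' - g') p v := by
  have h := HasDerivAt.sub hf hg
  simpa only [zero_smul, add_zero] using! h

theorem hasLineDerivAt_const_mul (c : ℝ) (hf : HasLineDerivAt ℝ f f' p v) :
    HasLineDerivAt ℝ (fun q => c * f q) (c * f') p v := by
  have h := HasDerivAt.const_mul c hf
  simpa only [zero_smul, add_zero] using! h

theorem hasLineDerivAt_div (hf : HasLineDerivAt ℝ f f' p v) (hg : HasLineDerivAt ℝ g g' p v)
    (h : g p ≠ 0) :
    HasLineDerivAt ℝ (fun q => f q / g q) ((f' * g p - f p * g') / g p ^ 2) p v := by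
  have := HasDerivAt.div hf hg (by simpa using h)
  simpa only [zero_smul, add_zero] using! this

theorem hasLineDerivAt_sum {ι : Type*} (s : Finset ι) {f : ι → Space n m → ℝ} {f' : ι → ℝ}
    (h : ∀ i ∈ s, HasLineDerivAt ℝ (f i) (f' i) p v) :
    HasLineDerivAt ℝ (fun q => ∑ i ∈ s, f i q) (∑ i ∈ s, f' i) p v :=
  HasDerivAt.fun_sum h

theorem hasLineDerivAt_comp {φ : ℝ → ℝ} {φ' : ℝ} (hφ : HasDerivAt φ φ' (f p))
    (hf : HasLineDerivAt ℝ f f' p v) :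
    HasLineDerivAt ℝ (fun q => φ (f q)) (φ' * f') p v := by
  have h : HasDerivAt φ φ' (f (p + (0 : ℝ) • v)) := by simpa using hφ
  exact h.comp (0 : ℝ) hf

variable (G a) (i : Fin n) (p)

theorem hasLineDerivAt_fst (l : Fin n) :
    HasLineDerivAt ℝ (fun q : Space n m => q.1 l) (if l = i then 1 else 0) p (G.field i p) := by
  have : HasDerivAt (fun t : ℝ => p.1 l + t * (if l = i then 1 else 0)) (if l = i then 1 else 0)
      0 := by
    simpa using ((hasDerivAt_id (0 : ℝ)).mul_const (if l = i then (1 : ℝ) else 0)).const_add (p.1 l)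
  refine this.congr_of_eventuallyEq (Eventually.of_forall fun t => ?_)
  simp [field]

theorem hasLineDerivAt_snd (k : Fin m) :
    HasLineDerivAt ℝ (fun q : Space n m => q.2 k) ((1 / 2) * G.twist k p i) p (G.field i p) := by
  have : HasDerivAt (fun t : ℝ => p.2 k + t * ((1 / 2) * G.twist k p i))
      ((1 / 2) * G.twist k p i) 0 := by
    simpa using ((hasDerivAt_id (0 : ℝ)).mul_const ((1 / 2) * G.twist k p i)).const_add (p.2 k)
  refine this.congr_of_eventuallyEq (Eventually.of_forall fun t => ?_)
  simp [field, twist, Matrix.mulVec, dotProduct]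

theorem hasLineDerivAt_pencil (j l : Fin n) :
    HasLineDerivAt ℝ (fun q => G.pencil q j l) ((1 / 2) * ∑ k, G.twist k p i * G.Λ k j l) p
      (G.field i p) := by
  simp only [pencil_apply]
  convert hasLineDerivAt_sum Finset.univ fun k _ =>
    hasLineDerivAt_const_mul (G.Λ k j l) (G.hasLineDerivAt_snd p i k) using 1
  · simp only [mul_comm]
  · rw [Finset.mul_sum]
    exact Finset.sum_congr rfl fun k _ => by ring

theorem hasLineDerivAt_rot (j : Fin n) :
    HasLineDerivAt ℝ (fun q => G.rot q j) (G.dRot i j p) p (G.field i p) := by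
  convert hasLineDerivAt_sum Finset.univ fun l _ =>
    hasLineDerivAt_mul (G.hasLineDerivAt_pencil p i j l) (G.hasLineDerivAt_fst p i l) using 1
  · rfl
  simp only [dRot, mul_ite, mul_one, mul_zero, Finset.sum_add_distrib, Finset.sum_ite_eq',
    Finset.mem_univ, if_true]
  rw [add_comm]
  congr 1
  simp only [mul_assoc, ← Finset.mul_sum, Finset.sum_mul]
  rw [Finset.sum_comm]
  simp only [twist, Matrix.mulVec, dotProduct, Finset.mul_sum]

theorem hasLineDerivAt_rot2 (j : Fin n) :
    HasLineDerivAt ℝ (fun q => G.rot2 q j) (G.dRot2 i j p) p (G.field i p) :=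
  hasLineDerivAt_sum Finset.univ fun l _ =>
    hasLineDerivAt_mul (G.hasLineDerivAt_pencil p i l j) (G.hasLineDerivAt_rot p i l)

theorem hasLineDerivAt_rotSq :
    HasLineDerivAt ℝ G.rotSq (G.dRotSq i p) p (G.field i p) := by
  convert hasLineDerivAt_sum Finset.univ fun j _ =>
    hasLineDerivAt_mul (G.hasLineDerivAt_rot p i j) (G.hasLineDerivAt_rot p i j) using 1
  · rfl
  simp only [dRotSq, dRot, rot2, Matrix.mulVec, dotProduct, Matrix.transpose_apply,
    Finset.mul_sum]
  rw [Finset.sum_comm (s := (Finset.univ : Finset (Fin m))), ← Finset.sum_add_distrib]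
  refine Finset.sum_congr rfl fun j _ => ?_
  simp only [add_mul, mul_add, Finset.sum_mul, Finset.mul_sum]
  have : ∀ A B C D : ℝ, C = B + D → 2 * A + C = A + B + (A + D) := fun _ _ _ _ h => by
    rw [h]; ring
  rw [mul_comm (G.rot p j) (G.pencil p j i)]
  apply this
  rw [← Finset.sum_add_distrib]
  exact Finset.sum_congr rfl fun k _ => by ring

theorem hasLineDerivAt_horSq :
    HasLineDerivAt ℝ horSq (2 * p.1 i) p (G.field i p) := by
  convert hasLineDerivAt_sum Finset.univ fun l _ =>
    hasLineDerivAt_mul (G.hasLineDerivAt_fst p i l) (G.hasLineDerivAt_fst p i l) using 1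
  · rfl
  · simp [Finset.sum_add_distrib, two_mul]

theorem hasLineDerivAt_gaugeFour :
    HasLineDerivAt ℝ (gaugeFour a) (G.dGaugeFour a i p) p (G.field i p) := by
  have h1 := hasLineDerivAt_mul (G.hasLineDerivAt_horSq p i) (G.hasLineDerivAt_horSq p i)
  have h2 := hasLineDerivAt_sum Finset.univ fun k _ =>
    hasLineDerivAt_mul (G.hasLineDerivAt_snd p i k) (G.hasLineDerivAt_snd p i k)
  convert hasLineDerivAt_add h1 (hasLineDerivAt_const_mul a h2) using 1
  · funext q
    rw [gaugeFour, sq]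
    rfl
  · rw [dGaugeFour, rot_apply]
    congr 1
    · ring
    · congr 1
      exact Finset.sum_congr rfl fun k _ => by ring

end HorizontalCalculus

end StepTwoCarnot

section SkewMatrices

open scoped Matrix

variable {ι : Type*} [Fintype ι]

theorem Matrix.dotProduct_mulVec_self_of_skew {A : Matrix ι ι ℝ} (hA : Aᵀ = -A) (u : ι → ℝ) :
    u ⬝ᵥ A *ᵥ u = 0 := by
  have h : u ⬝ᵥ A *ᵥ u = u ⬝ᵥ Aᵀ *ᵥ u := by
    rw [Matrix.dotProduct_mulVec, Matrix.mulVec_transpose, dotProduct_comm]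
  rw [hA, Matrix.neg_mulVec, dotProduct_neg] at h
  linarith

theorem sq_dotProduct_le (u v : ι → ℝ) : (u ⬝ᵥ v) ^ 2 ≤ (u ⬝ᵥ u) * (v ⬝ᵥ v) := by
  simpa [dotProduct, sq] using Finset.sum_mul_sq_le_sq_mul_sq Finset.univ u v

theorem dotProduct_self_nonneg' (u : ι → ℝ) : 0 ≤ u ⬝ᵥ u :=
  Finset.sum_nonneg fun _ _ => mul_self_nonneg _

theorem Matrix.mulVec_dotProduct_self_le (A : Matrix ι ι ℝ) (u : ι → ℝ) :
    A *ᵥ u ⬝ᵥ A *ᵥ u ≤ (∑ i, ∑ j, A i j ^ 2) * (u ⬝ᵥ u) := by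
  rw [Finset.sum_mul]
  refine Finset.sum_le_sum fun i _ => ?_
  have := sq_dotProduct_le (A i) u
  rw [← sq]
  refine this.trans (le_of_eq ?_)
  simp only [dotProduct, sq]

/-- The operator norm of a real skew-symmetric matrix is attained on a plane. -/
theorem Matrix.two_mul_mulVec_dotProduct_self_le_of_skew {A : Matrix ι ι ℝ} (hA : Aᵀ = -A)
    (u : ι → ℝ) : 2 * (A *ᵥ u ⬝ᵥ A *ᵥ u) ≤ (∑ i, ∑ j, A i j ^ 2) * (u ⬝ᵥ u) := by
  set v := A *ᵥ u with hv
  have huv : u ⬝ᵥ v = 0 := Matrix.dotProduct_mulVec_self_of_skew hA u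
  set U := u ⬝ᵥ u with hU
  set V := v ⬝ᵥ v with hV
  set Q := ∑ i, ∑ j, A i j ^ 2 with hQ
  have e1 : ∑ i, ∑ j, A i j * (v i * u j) = V := by
    simp only [hV, dotProduct]
    refine Finset.sum_congr rfl fun i _ => ?_
    rw [show v i = ∑ j, A i j * u j from rfl, Finset.mul_sum]
    exact Finset.sum_congr rfl fun j _ => by
      rw [show (∑ j, A i j * u j) = v i from rfl]; ring
  have e2 : ∑ i, ∑ j, A i j * (u i * v j) = -V := by
    rw [Finset.sum_comm, ← e1, ← Finset.sum_neg_distrib]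
    refine Finset.sum_congr rfl fun i _ => ?_
    rw [← Finset.sum_neg_distrib]
    refine Finset.sum_congr rfl fun j _ => ?_
    have : A j i = -A i j := by simpa using congrFun (congrFun hA i) j
    rw [this]; ring
  have prodsum : ∀ f g : ι → ℝ, ∑ i, ∑ j, f i * g j = (∑ i, f i) * ∑ j, g j := fun f g => by
    rw [Finset.sum_mul_sum]
  have e3 : ∑ i, ∑ j, (v i * v i) * (u j * u j) = V * U := prodsum _ _
  have e4 : ∑ i, ∑ j, (u i * u i) * (v j * v j) = U * V := prodsum _ _
  have e5 : ∑ i, ∑ j, (u i * v i) * (u j * v j) = 0 := by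
    rw [prodsum]
    change (u ⬝ᵥ v) * (u ⬝ᵥ v) = 0
    rw [huv, zero_mul]
  simp only [← Finset.mul_sum] at e3 e4 e5
  have e6 : ∑ i, ∑ j, (U * A i j - (v i * u j - u i * v j)) ^ 2 = U ^ 2 * Q - 2 * U * V := by
    have : ∀ i j, (U * A i j - (v i * u j - u i * v j)) ^ 2 =
        U ^ 2 * A i j ^ 2 - 2 * U * (A i j * (v i * u j)) + 2 * U * (A i j * (u i * v j)) +
        (v i * v i) * (u j * u j) + (u i * u i) * (v j * v j) -
        2 * ((u i * v i) * (u j * v j)) := fun i j => by ring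
    simp only [this, Finset.sum_add_distrib, Finset.sum_sub_distrib, ← Finset.mul_sum, e1, e2, e3,
      e4, e5]
    ring
  have h0 : 0 ≤ U ^ 2 * Q - 2 * U * V := by
    rw [← e6]
    exact Finset.sum_nonneg fun i _ => Finset.sum_nonneg fun j _ => sq_nonneg _
  have hU0 : 0 ≤ U := dotProduct_self_nonneg' u
  rcases hU0.eq_or_lt with h | h
  · have : u = 0 := dotProduct_self_eq_zero.1 h.symm
    have hv0 : v = 0 := by rw [hv, this, Matrix.mulVec_zero]
    have hV0 : V = 0 := by rw [hV, hv0, dotProduct_zero]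
    rw [hV0, ← h]; simp
  · have : 0 ≤ U * (Q * U - 2 * V) := by
      linarith [h0, show U * (Q * U - 2 * V) = U ^ 2 * Q - 2 * U * V by ring]
    linarith [nonneg_of_mul_nonneg_right this h]

end SkewMatrices

namespace StepTwoCarnot

section Contractions

open scoped Matrix

variable {n m : ℕ} (G : StepTwoCarnot n m) (a : ℝ) (p : Space n m)

/-- `∑ₖ |Λ⁽ᵏ⁾ x|²`. -/
noncomputable def twistSq : ℝ := ∑ k, G.twist k p ⬝ᵥ G.twist k p

/-- The squared Frobenius norm of `Λ(z)`. -/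
noncomputable def frobSq : ℝ := ∑ i, ∑ j, G.pencil p i j ^ 2

/-- The sum of the squared Frobenius norms of the structure matrices. -/
noncomputable def totalSq : ℝ := ∑ k, ∑ i, ∑ j, G.Λ k i j ^ 2

theorem hor_dot_rot : p.1.ofLp ⬝ᵥ G.rot p = 0 :=
  Matrix.dotProduct_mulVec_self_of_skew (G.pencil_skew p) _

theorem rot_dot_rot2 : G.rot p ⬝ᵥ G.rot2 p = 0 := by
  rw [rot2, pencil_skew, Matrix.neg_mulVec, dotProduct_neg,
    Matrix.dotProduct_mulVec_self_of_skew (G.pencil_skew p), neg_zero]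

theorem hor_dot_rot2 : p.1.ofLp ⬝ᵥ G.rot2 p = G.rotSq p := by
  rw [rot2, Matrix.dotProduct_mulVec, Matrix.vecMul_transpose]; rfl

theorem sum_dRot : ∑ i, G.dRot i i p = (1 / 2) * G.twistSq p := by
  simp only [dRot, Finset.sum_add_distrib, ← Finset.mul_sum, twistSq, dotProduct]
  rw [Finset.sum_comm]
  have : ∀ i, G.pencil p i i = 0 := fun i => by
    simp [pencil_apply, G.diag_eq_zero]
  simp [this]

theorem sum_mul_dRotSq (u : Fin n → ℝ) : ∑ i, u i * G.dRotSq i p =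
    2 * (u ⬝ᵥ G.rot2 p) + ∑ k, (G.twist k p ⬝ᵥ u) * (G.twist k p ⬝ᵥ G.rot p) := by
  simp only [dRotSq, mul_add, Finset.sum_add_distrib]
  congr 1
  · simp only [dotProduct, Finset.mul_sum]
    exact Finset.sum_congr rfl fun _ _ => by ring
  · simp only [Finset.mul_sum]
    rw [Finset.sum_comm]
    refine Finset.sum_congr rfl fun k _ => ?_
    rw [show G.twist k p ⬝ᵥ u = ∑ i, G.twist k p i * u i from rfl, Finset.sum_mul]
    exact Finset.sum_congr rfl fun _ _ => by ring

theorem sum_rot_mul_dRotSq : ∑ i, G.rot p i * G.dRotSq i p =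
    ∑ k, (G.twist k p ⬝ᵥ G.rot p) ^ 2 := by
  rw [sum_mul_dRotSq, rot_dot_rot2]
  simp [sq]

theorem sum_rot2_mul_dRotSq : ∑ i, G.rot2 p i * G.dRotSq i p =
    2 * (G.rot2 p ⬝ᵥ G.rot2 p) + ∑ k, (G.twist k p ⬝ᵥ G.rot2 p) * (G.twist k p ⬝ᵥ G.rot p) :=
  G.sum_mul_dRotSq p _

theorem sum_mul_dGaugeFour (u : Fin n → ℝ) : ∑ i, u i * G.dGaugeFour a i p =
    4 * horSq p * (p.1.ofLp ⬝ᵥ u) + a * (u ⬝ᵥ G.rot p) := by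
  simp only [dGaugeFour, dotProduct, Finset.mul_sum, ← Finset.sum_add_distrib]
  exact Finset.sum_congr rfl fun _ _ => by ring

theorem sum_rot_mul_dGaugeFour : ∑ i, G.rot p i * G.dGaugeFour a i p = a * G.rotSq p := by
  rw [sum_mul_dGaugeFour, hor_dot_rot, mul_zero, zero_add]; rfl

theorem sum_rot2_mul_dGaugeFour :
    ∑ i, G.rot2 p i * G.dGaugeFour a i p = 4 * horSq p * G.rotSq p := by
  rw [sum_mul_dGaugeFour, hor_dot_rot2, dotProduct_comm, rot_dot_rot2, mul_zero, add_zero]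

theorem sum_hor_mul_dGaugeFour : ∑ i, p.1 i * G.dGaugeFour a i p = 4 * horSq p ^ 2 := by
  rw [G.sum_mul_dGaugeFour a p p.1.ofLp, hor_dot_rot]
  rw [show p.1.ofLp ⬝ᵥ p.1.ofLp = horSq p from rfl]; ring

theorem sum_dRot2 : ∑ i, G.dRot2 i i p =
    G.frobSq p + (1 / 2) * ∑ k, G.twist k p ⬝ᵥ (G.Λ k)ᵀ *ᵥ G.rot p := by
  simp only [dRot2, dRot, mul_add, Finset.sum_add_distrib]
  have e1 : ∑ i, ∑ l, G.pencil p l i * G.pencil p l i = G.frobSq p := by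
    rw [Finset.sum_comm]
    simp only [frobSq, sq]
  have e2 : ∑ i, ∑ l, G.pencil p l i * ((1 / 2) * ∑ k, G.twist k p i * G.twist k p l) = 0 := by
    have : ∀ k, ∑ i, ∑ l, G.pencil p l i * (G.twist k p i * G.twist k p l) = 0 := fun k => by
      rw [Finset.sum_comm]
      have := Matrix.dotProduct_mulVec_self_of_skew (G.pencil_skew p) (G.twist k p)
      rw [← this]
      simp only [dotProduct, Matrix.mulVec, Finset.mul_sum]
      exact Finset.sum_congr rfl fun _ _ => Finset.sum_congr rfl fun _ _ => by ring
    have e : ∀ i l, G.pencil p l i * ((1 / 2) * ∑ k, G.twist k p i * G.twist k p l) =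
        (1 / 2) * ∑ k, G.pencil p l i * (G.twist k p i * G.twist k p l) := fun i l => by
      rw [← Finset.mul_sum]; ring
    simp only [e, ← Finset.mul_sum]
    have : ∑ i, ∑ l, ∑ k, G.pencil p l i * (G.twist k p i * G.twist k p l) = 0 := by
      calc _ = ∑ i, ∑ k, ∑ l, G.pencil p l i * (G.twist k p i * G.twist k p l) :=
            Finset.sum_congr rfl fun i _ => Finset.sum_comm
        _ = ∑ k, ∑ i, ∑ l, G.pencil p l i * (G.twist k p i * G.twist k p l) := Finset.sum_comm
        _ = 0 := by simp only [this, Finset.sum_const_zero]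
    rw [show ∑ i, ∑ l, G.pencil p l i * ∑ k, G.twist k p i * G.twist k p l =
      ∑ i, ∑ l, ∑ k, G.pencil p l i * (G.twist k p i * G.twist k p l) by
        simp only [Finset.mul_sum], this, mul_zero]
  rw [e1, e2, add_zero, add_comm]
  congr 1
  have e : ∀ i l, (1 / 2) * (∑ k, G.twist k p i * G.Λ k l i) * G.rot p l =
      (1 / 2) * ∑ k, G.twist k p i * (G.Λ k l i * G.rot p l) := fun i l => by
    rw [mul_assoc, Finset.sum_mul]
    simp only [mul_assoc]
  simp only [e, ← Finset.mul_sum]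
  congr 1
  calc _ = ∑ i, ∑ k, ∑ l, G.twist k p i * (G.Λ k l i * G.rot p l) :=
        Finset.sum_congr rfl fun i _ => Finset.sum_comm
    _ = ∑ k, ∑ i, ∑ l, G.twist k p i * (G.Λ k l i * G.rot p l) := Finset.sum_comm
    _ = _ := by
      simp only [dotProduct, Matrix.mulVec, Matrix.transpose_apply, Finset.mul_sum]

theorem horSq_nonneg : 0 ≤ horSq p := dotProduct_self_nonneg' _

theorem rotSq_nonneg : 0 ≤ G.rotSq p := dotProduct_self_nonneg' _

theorem twistSq_nonneg : 0 ≤ G.twistSq p :=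
  Finset.sum_nonneg fun _ _ => dotProduct_self_nonneg' _

theorem frobSq_nonneg : 0 ≤ G.frobSq p :=
  Finset.sum_nonneg fun _ _ => Finset.sum_nonneg fun _ _ => sq_nonneg _

theorem totalSq_nonneg : 0 ≤ G.totalSq :=
  Finset.sum_nonneg fun _ _ => Finset.sum_nonneg fun _ _ => Finset.sum_nonneg fun _ _ =>
    sq_nonneg _

theorem twistSq_le : G.twistSq p ≤ G.totalSq * horSq p := by
  rw [totalSq, Finset.sum_mul]
  exact Finset.sum_le_sum fun k _ => Matrix.mulVec_dotProduct_self_le _ _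

theorem frobSq_le : G.frobSq p ≤ G.totalSq * (p.2.ofLp ⬝ᵥ p.2.ofLp) := by
  have h : ∀ i j, G.pencil p i j ^ 2 ≤ (∑ k, G.Λ k i j ^ 2) * (p.2.ofLp ⬝ᵥ p.2.ofLp) := by
    intro i j
    rw [pencil_apply, mul_comm]
    have := sq_dotProduct_le p.2.ofLp (fun k => G.Λ k i j)
    simpa only [dotProduct, sq] using this
  calc G.frobSq p ≤ ∑ i, ∑ j, (∑ k, G.Λ k i j ^ 2) * (p.2.ofLp ⬝ᵥ p.2.ofLp) :=
        Finset.sum_le_sum fun i _ => Finset.sum_le_sum fun j _ => h i j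
    _ = _ := by
      simp only [← Finset.sum_mul, totalSq]
      congr 1
      rw [Finset.sum_comm (s := (Finset.univ : Finset (Fin m)))]
      exact Finset.sum_congr rfl fun i _ => Finset.sum_comm

theorem rotSq_le : G.rotSq p ≤ G.frobSq p * horSq p := Matrix.mulVec_dotProduct_self_le _ _

theorem two_mul_rot2_dot_self_le :
    2 * (G.rot2 p ⬝ᵥ G.rot2 p) ≤ G.frobSq p * G.rotSq p := by
  have := Matrix.two_mul_mulVec_dotProduct_self_le_of_skew (G.pencil_skew p) (G.rot p)
  rwa [rot2, pencil_skew, Matrix.neg_mulVec, neg_dotProduct, dotProduct_neg, neg_neg]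

theorem sum_twist_dot_mul_le {r : ℝ} (hr : 0 < r) :
    ∑ k, (G.twist k p ⬝ᵥ G.rot2 p) * (G.twist k p ⬝ᵥ G.rot p) ≤
      G.twistSq p * ((G.rot2 p ⬝ᵥ G.rot2 p) / r + r * G.rotSq p) / 2 := by
  rw [twistSq, Finset.sum_mul, Finset.sum_div]
  refine Finset.sum_le_sum fun k _ => ?_
  have h1 := sq_dotProduct_le (G.twist k p) (G.rot2 p)
  have h2 := sq_dotProduct_le (G.twist k p) (G.rot p)
  set A := G.twist k p ⬝ᵥ G.rot2 p
  set B := G.twist k p ⬝ᵥ G.rot p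
  have h3 : 2 * (A * B) ≤ A ^ 2 / r + r * B ^ 2 := by
    have : 0 ≤ (A - r * B) ^ 2 / r := by positivity
    have e : (A - r * B) ^ 2 / r = A ^ 2 / r + r * B ^ 2 - 2 * (A * B) := by
      field_simp; ring
    linarith
  have h4 : A ^ 2 / r ≤ (G.twist k p ⬝ᵥ G.twist k p) * (G.rot2 p ⬝ᵥ G.rot2 p) / r := by gcongr
  have h5 : r * B ^ 2 ≤ r * ((G.twist k p ⬝ᵥ G.twist k p) * G.rotSq p) := by
    gcongr; exact h2
  rw [le_div_iff₀ two_pos]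
  have e : (G.twist k p ⬝ᵥ G.twist k p) * ((G.rot2 p ⬝ᵥ G.rot2 p) / r + r * G.rotSq p) =
    (G.twist k p ⬝ᵥ G.twist k p) * (G.rot2 p ⬝ᵥ G.rot2 p) / r +
      r * ((G.twist k p ⬝ᵥ G.twist k p) * G.rotSq p) := by ring
  linarith

theorem neg_sum_twist_dot_le {r : ℝ} (hr : 0 < r) :
    -∑ k, G.twist k p ⬝ᵥ (G.Λ k)ᵀ *ᵥ G.rot p ≤
      (r * G.twistSq p + G.totalSq * G.rotSq p / r) / 2 := by
  have e : (r * G.twistSq p + G.totalSq * G.rotSq p / r) / 2 =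
      ∑ k, (r * (G.twist k p ⬝ᵥ G.twist k p) + (∑ i, ∑ j, G.Λ k i j ^ 2) * G.rotSq p / r) / 2 := by
    rw [← Finset.sum_div, Finset.sum_add_distrib, ← Finset.mul_sum, ← Finset.sum_div,
      ← Finset.sum_mul]
    rfl
  rw [e, ← Finset.sum_neg_distrib]
  refine Finset.sum_le_sum fun k _ => ?_
  have h1 : ((G.Λ k)ᵀ *ᵥ G.rot p) ⬝ᵥ ((G.Λ k)ᵀ *ᵥ G.rot p) ≤
      (∑ i, ∑ j, G.Λ k i j ^ 2) * G.rotSq p := by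
    have := Matrix.mulVec_dotProduct_self_le (G.Λ k) (G.rot p)
    rwa [G.skew k, Matrix.neg_mulVec, neg_dotProduct, dotProduct_neg, neg_neg]
  set c := (G.Λ k)ᵀ *ᵥ G.rot p
  have h2 : 0 ≤ (r • G.twist k p + c) ⬝ᵥ (r • G.twist k p + c) := dotProduct_self_nonneg' _
  have e2 : (r • G.twist k p + c) ⬝ᵥ (r • G.twist k p + c) =
      r ^ 2 * (G.twist k p ⬝ᵥ G.twist k p) + 2 * r * (G.twist k p ⬝ᵥ c) + c ⬝ᵥ c := by
    simp only [add_dotProduct, dotProduct_add, smul_dotProduct, dotProduct_smul, smul_eq_mul]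
    rw [dotProduct_comm c]
    ring
  rw [e2] at h2
  have h3 : -(2 * (G.twist k p ⬝ᵥ c)) ≤ (r ^ 2 * (G.twist k p ⬝ᵥ G.twist k p) +
      (∑ i, ∑ j, G.Λ k i j ^ 2) * G.rotSq p) / r := by
    rw [le_div_iff₀ hr]
    linarith
  have e3 : (r ^ 2 * (G.twist k p ⬝ᵥ G.twist k p) +
      (∑ i, ∑ j, G.Λ k i j ^ 2) * G.rotSq p) / r = r * (G.twist k p ⬝ᵥ G.twist k p) +
      (∑ i, ∑ j, G.Λ k i j ^ 2) * G.rotSq p / r := by field_simp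
  linarith

/-- Linear independence of the structure matrices bounds `Λ(z)` from below. -/
theorem exists_frobSq_ge : ∃ γ > 0, ∀ p : Space n m, γ * (p.2.ofLp ⬝ᵥ p.2.ofLp) ≤ G.frobSq p := by
  let T : (Fin m → ℝ) →ₗ[ℝ] (Fin n → Fin n → ℝ) :=
    { toFun := fun z i j => ∑ k, z k * G.Λ k i j
      map_add' := fun z w => by
        funext i j; simp [add_mul, Finset.sum_add_distrib]
      map_smul' := fun c z => by
        funext i j; simp [Finset.mul_sum, mul_assoc] }
  have hT : LinearMap.ker T = ⊥ := by
    rw [LinearMap.ker_eq_bot']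
    intro z hz
    have := Fintype.linearIndependent_iff.1 G.indep z (by
      ext i j
      have := congrFun (congrFun hz i) j
      simpa [T, Matrix.sum_apply] using this)
    exact funext this
  obtain ⟨C, hC, hanti⟩ := T.exists_antilipschitzWith hT
  have hC' : (0 : ℝ) < C := hC
  refine ⟨1 / (m * C ^ 2 + 1), by positivity, fun p => ?_⟩
  have hz : ‖p.2.ofLp‖ ≤ C * ‖T p.2.ofLp‖ := by
    simpa [dist_eq_norm] using hanti.le_mul_dist p.2.ofLp 0
  have hTn : ‖T p.2.ofLp‖ ^ 2 ≤ G.frobSq p := by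
    have hle : ‖T p.2.ofLp‖ ≤ √(G.frobSq p) := by
      refine (pi_norm_le_iff_of_nonneg (Real.sqrt_nonneg _)).2 fun i =>
        (pi_norm_le_iff_of_nonneg (Real.sqrt_nonneg _)).2 fun j => ?_
      rw [Real.norm_eq_abs]
      refine Real.abs_le_sqrt ?_
      rw [show T p.2.ofLp i j = G.pencil p i j from (G.pencil_apply p i j).symm]
      calc G.pencil p i j ^ 2 ≤ ∑ j, G.pencil p i j ^ 2 :=
            Finset.single_le_sum (f := fun j => G.pencil p i j ^ 2)
              (fun _ _ => sq_nonneg _) (Finset.mem_univ j)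
        _ ≤ G.frobSq p := Finset.single_le_sum (f := fun i => ∑ j, G.pencil p i j ^ 2)
              (fun _ _ => Finset.sum_nonneg fun _ _ => sq_nonneg _) (Finset.mem_univ i)
    calc _ ≤ √(G.frobSq p) ^ 2 := by gcongr
      _ = _ := Real.sq_sqrt (G.frobSq_nonneg p)
  have hdot : p.2.ofLp ⬝ᵥ p.2.ofLp ≤ m * ‖p.2.ofLp‖ ^ 2 := by
    calc p.2.ofLp ⬝ᵥ p.2.ofLp ≤ ∑ _k : Fin m, ‖p.2.ofLp‖ ^ 2 := by
          refine Finset.sum_le_sum fun k _ => ?_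
          rw [← sq, ← sq_abs]
          gcongr
          exact norm_le_pi_norm p.2.ofLp k
      _ = _ := by simp
  have : p.2.ofLp ⬝ᵥ p.2.ofLp ≤ (m * C ^ 2 + 1) * G.frobSq p := by
    calc p.2.ofLp ⬝ᵥ p.2.ofLp ≤ m * ‖p.2.ofLp‖ ^ 2 := hdot
      _ ≤ m * (C * ‖T p.2.ofLp‖) ^ 2 := by gcongr
      _ = m * C ^ 2 * ‖T p.2.ofLp‖ ^ 2 := by ring
      _ ≤ m * C ^ 2 * G.frobSq p := by gcongr
      _ ≤ _ := by nlinarith [G.frobSq_nonneg p]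
  rw [one_div, inv_mul_le_iff₀ (by positivity)]
  exact this

end Contractions

end StepTwoCarnot

section ScalarEstimates

theorem hasDerivAt_sq_max_zero (c x : ℝ) :
    HasDerivAt (fun x => max 0 (c - x) ^ 2) (-2 * max 0 (c - x)) x := by
  rcases lt_trichotomy x c with h | h | h
  · have h1 : HasDerivAt (fun x => (c - x) ^ 2) (-2 * (c - x)) x := by
      refine (((hasDerivAt_id x).const_sub c).pow 2).congr_deriv ?_
      simp
    rw [max_eq_right (by linarith)]
    refine h1.congr_of_eventuallyEq ?_
    filter_upwards [eventually_lt_nhds h] with y hy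
    rw [max_eq_right (by linarith)]
  · subst h
    rw [sub_self, max_self, mul_zero, hasDerivAt_iff_isLittleO_nhds_zero]
    simp only [sub_self, max_self, smul_zero, sub_zero]
    refine Asymptotics.IsBigO.trans_isLittleO (g := fun h : ℝ => h ^ 2) ?_ ?_
    · refine Asymptotics.IsBigO.of_bound 1 (Filter.Eventually.of_forall fun h => ?_)
      have h1 : 0 ≤ max 0 (x - (x + h)) := le_max_left _ _
      have h2 : max 0 (x - (x + h)) ≤ |h| := max_le (abs_nonneg _) (by
        linarith [neg_abs_le h])
      have h3 : max 0 (x - (x + h)) ^ 2 ≤ |h| ^ 2 := by gcongr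
      rw [sq_abs] at h3
      simp only [ne_eq, OfNat.ofNat_ne_zero, not_false_eq_true, zero_pow, sub_zero, norm_pow,
        Real.norm_eq_abs, sq_abs, one_mul]
      exact h3
    · simpa using Asymptotics.isLittleO_pow_id (𝕜 := ℝ) one_lt_two
  · rw [max_eq_left (by linarith), mul_zero]
    refine (hasDerivAt_const x (0 : ℝ)).congr_of_eventuallyEq ?_
    filter_upwards [eventually_gt_nhds h] with y hy
    rw [max_eq_left (by linarith)]
    simp

theorem twist_term_le {H S T X c k : ℝ} (hS : 0 ≤ S) (hT : 0 < T) (hH : 0 ≤ H) (hc0 : 0 < c)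
    (hXc : X ≤ c) (hk : k ≤ H * X) :
    (k / 2) * (S + 4 * T) / (S + T) ^ 2 ≤ 2 * H * c / (S + T) := by
  set σ := S + T with hσ
  have hσ0 : 0 < σ := by positivity
  have hSσ : S ≤ σ := by linarith
  have hTσ : T ≤ σ := by linarith
  rw [div_le_div_iff₀ (by positivity) hσ0]
  have h1 : k / 2 * (S + 4 * T) ≤ (H * c / 2) * (4 * σ) := by
    have : k / 2 ≤ H * c / 2 := by nlinarith
    have h4 : S + 4 * T ≤ 4 * σ := by linarith
    calc k / 2 * (S + 4 * T) ≤ (H * c / 2) * (S + 4 * T) := by gcongr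
      _ ≤ _ := by gcongr
  nlinarith [mul_le_mul_of_nonneg_right h1 hσ0.le]

theorem rotation_term_le {a S T r : ℝ} (hS : 0 ≤ S) (hT : 0 < T) (hr : 0 ≤ r) :
    (r - 4 * a * S) / (S + T) ^ 2 - 2 * (S + 4 * T) * (r - a * S) / (S + T) ^ 3 ≤
      a * S * (4 * T - 2 * S) / (S + T) ^ 3 := by
  set σ := S + T with hσ
  have hσ0 : 0 < σ := by positivity
  have hSσ : S ≤ σ := by linarith
  have hTσ : T ≤ σ := by linarith
  have e : (r - 4 * a * S) / σ ^ 2 - 2 * (S + 4 * T) * (r - a * S) / σ ^ 3 =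
      (a * S * (4 * T - 2 * S) - r * (S + 7 * T)) / σ ^ 3 := by
    rw [hσ]; field_simp; ring
  rw [e]
  gcongr
  have : 0 ≤ r * (S + 7 * T) := by positivity
  linarith

theorem radial_term_le {a g h H K c S T X M φ γ β : ℝ} (hg : 0 < g) (hK0 : 0 < K)
    (hK : K * g = 12 * a) (ha : 0 < a)
    (hc0 : 0 < c) (hc1 : c ≤ 1 / 2) (hh : 0 ≤ h) (hH : 0 ≤ H) (hS : 0 ≤ S) (hT : 0 < T)
    (hX0 : 0 ≤ X) (hXc : X ≤ c) (hM : 2 * M ≤ φ * S) (hφ' : g * (1 - X ^ 2 - T) ≤ φ)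
    (hγ : γ ≤ H * (1 + h / 2) * X * S) (hβ : -β ≤ H * (1 + h) * X) :
    -(K * ((φ + β / 2) / (S + T) - (2 * M + γ - 4 * X * S) / (S + T) ^ 2)) ≤
      12 * a - 6 * a * T / (S + T) ^ 2 + c * (K * (H * (1 + h)) + K * (H * (1 + h / 2))) / (S + T) := by
  set σ := S + T with hσ
  have hσ0 : 0 < σ := by positivity
  have hSσ : S ≤ σ := by linarith
  have hTσ : T ≤ σ := by linarith
  have e : -(K * ((φ + β / 2) / σ - (2 * M + γ - 4 * X * S) / σ ^ 2)) =
      K * (2 * M - φ * σ + (-β / 2) * σ + γ - 4 * X * S) / σ ^ 2 := by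
    field_simp; ring
  have e2 : 12 * a - 6 * a * T / σ ^ 2 + c * (K * (H * (1 + h)) + K * (H * (1 + h / 2))) / σ =
      (12 * a * σ ^ 2 - 6 * a * T + c * (K * (H * (1 + h)) + K * (H * (1 + h / 2))) * σ)
        / σ ^ 2 := by
    field_simp
  rw [e, e2]
  gcongr
  have u1 : 2 * M - φ * σ ≤ -(φ * T) := by
    have : φ * σ = φ * S + φ * T := by rw [hσ]; ring
    linarith
  have u2 : g * (1 / 2 - T) ≤ φ := by
    have : X ^ 2 ≤ 1 / 2 := by nlinarith
    nlinarith
  have u3 : (g / 2) * T - g * T ^ 2 ≤ φ * T := by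
    have := mul_le_mul_of_nonneg_right u2 hT.le
    nlinarith
  have u4 : (-β / 2) * σ ≤ (H * (1 + h) * c) * σ := by
    gcongr
    have : H * (1 + h) * X ≤ H * (1 + h) * c := by gcongr
    have : 0 ≤ H * (1 + h) * X := by positivity
    linarith
  have u5 : γ ≤ H * (1 + h / 2) * c * σ := by
    refine hγ.trans ?_
    gcongr
  have u6 : 0 ≤ 4 * X * S := by positivity
  have u7 : 2 * M - φ * σ + (-β / 2) * σ + γ - 4 * X * S ≤
      -((g / 2) * T - g * T ^ 2) + (H * (1 + h) * c) * σ + H * (1 + h / 2) * c * σ := by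
    linarith
  have u8 := mul_le_mul_of_nonneg_left u7 hK0.le
  have u9 : K * (-((g / 2) * T - g * T ^ 2) + (H * (1 + h) * c) * σ + H * (1 + h / 2) * c * σ) =
      -(K * g / 2) * T + (K * g) * T ^ 2 +
        c * (K * (H * (1 + h)) + K * (H * (1 + h / 2))) * σ := by ring
  rw [u9, hK] at u8
  have : 12 * a * T ^ 2 ≤ 12 * a * σ ^ 2 := by gcongr
  linarith only [this, u8]

theorem main_term_le {a S T : ℝ} (ha : 0 < a) (hS : 0 ≤ S) (hT : 0 < T) :
    a * S * (4 * T - 2 * S) / (S + T) ^ 3 - 6 * a * T / (S + T) ^ 2 ≤ -a / (S + T) := by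
  set σ := S + T with hσ
  have hσ0 : 0 < σ := by positivity
  have hSσ : S ≤ σ := by linarith
  have hTσ : T ≤ σ := by linarith
  have e : a * S * (4 * T - 2 * S) / σ ^ 3 - 6 * a * T / σ ^ 2 - -a / σ =
      -(a * (S ^ 2 + 5 * T ^ 2)) / σ ^ 3 := by
    rw [hσ]; field_simp; ring
  have : -(a * (S ^ 2 + 5 * T ^ 2)) / σ ^ 3 ≤ 0 :=
    div_nonpos_of_nonpos_of_nonneg (by nlinarith [sq_nonneg S, sq_nonneg T]) (by positivity)
  linarith

theorem drift_sq_le {h K S T M : ℝ} (hS : 0 ≤ S) (hT : 0 < T) (hh : 0 ≤ h)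
    (hMh : 2 * M ≤ h * (S + T)) :
    2 * (S * (S + 4 * T) ^ 2 / (S + T) ^ 4) + 2 * (K ^ 2 * M / (S + T) ^ 2) ≤
      2 * (16 + K ^ 2 * h) / (S + T) := by
  set σ := S + T with hσ
  have hσ0 : 0 < σ := by positivity
  have hSσ : S ≤ σ := by linarith
  have hTσ : T ≤ σ := by linarith
  have h1 : S * (S + 4 * T) ^ 2 / σ ^ 4 ≤ 16 / σ := by
    rw [div_le_div_iff₀ (by positivity) hσ0]
    have : (S + 4 * T) ^ 2 ≤ (4 * σ) ^ 2 := by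
      have : S + 4 * T ≤ 4 * σ := by linarith
      gcongr
    calc S * (S + 4 * T) ^ 2 * σ ≤ σ * (4 * σ) ^ 2 * σ := by gcongr
      _ = 16 * σ ^ 4 := by ring
  have h2 : 2 * (K ^ 2 * M / σ ^ 2) ≤ K ^ 2 * h / σ := by
    have e : 2 * (K ^ 2 * M / σ ^ 2) = K ^ 2 * (2 * M) / σ ^ 2 := by ring
    have e' : K ^ 2 * h / σ = K ^ 2 * (h * σ) / σ ^ 2 := by field_simp
    rw [e, e']
    gcongr
  have e : 2 * (16 + K ^ 2 * h) / σ = 2 * (16 / σ) + 2 * (K ^ 2 * h / σ) := by ring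
  have : 0 ≤ K ^ 2 * h / σ := by positivity
  linarith

/-- The scale-free form of the divergence estimate. -/
theorem scalar_divergence_le {a g h H K c ε N S T X k r M φ γ β : ℝ} (ha : 0 < a) (hg : 0 < g)
    (hK : K * g = 12 * a) (hc0 : 0 < c) (hc1 : c ≤ 1 / 2) (hε : 0 ≤ ε) (hh : 0 ≤ h) (hH : 0 ≤ H)
    (hcC : c * (2 * H + K * (H * (1 + h / 2)) + K * (H * (1 + h))) ≤ a / 2)
    (hεC : ε * (4 * (16 + K ^ 2 * h)) ≤ a / 2)
    (hS : 0 ≤ S) (hT : 0 < T) (hX0 : 0 ≤ X) (hX1 : X ≤ 1) (hk : k ≤ H * X)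
    (hr : 0 ≤ r) (hM : 2 * M ≤ φ * S) (hφ : φ ≤ h) (hφ' : g * (1 - X ^ 2 - T) ≤ φ)
    (hγ : γ ≤ H * (1 + h / 2) * X * S) (hβ : -β ≤ H * (1 + h) * X) :
    4 * K * max 0 (c - X) * (S / (S + T)) + max 0 (c - X) ^ 2 *
      ((k / 2) * (S + 4 * T) / (S + T) ^ 2 + (r - 4 * a * S) / (S + T) ^ 2
        - 2 * (S + 4 * T) * (r - a * S) / (S + T) ^ 3
        - K * ((φ + β / 2) / (S + T) - (2 * M + γ - 4 * X * S) / (S + T) ^ 2)) + N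
      + ε * (2 * (max 0 (c - X) ^ 2) ^ 2 * (2 * (S * (S + 4 * T) ^ 2 / (S + T) ^ 4)
        + 2 * (K ^ 2 * M / (S + T) ^ 2)) + 2 * X)
      ≤ 4 * K + 12 * a + N + 2 * ε := by
  have hK0 : 0 < K := by
    by_contra hneg
    have := mul_nonpos_of_nonpos_of_nonneg (not_lt.1 hneg) hg.le
    linarith
  set σ := S + T with hσ
  have hσ0 : 0 < σ := by positivity
  set ζ := max 0 (c - X) with hζ
  have hζ0 : 0 ≤ ζ := le_max_left _ _
  have hζ1 : ζ ≤ 1 := max_le zero_le_one (by linarith only [hc1, hX0])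
  have hSσ : S ≤ σ := by linarith only [hσ, hT]
  have t1 : 4 * K * ζ * (S / σ) ≤ 4 * K := by
    have : S / σ ≤ 1 := (div_le_one hσ0).2 hSσ
    calc 4 * K * ζ * (S / σ) ≤ 4 * K * 1 * 1 := by gcongr
      _ = 4 * K := by ring
  have t2 : ε * (2 * X) ≤ 2 * ε := by
    rw [mul_comm 2 ε]
    exact mul_le_mul_of_nonneg_left (by linarith only [hX1]) hε
  rcases hζ0.eq_or_lt with hz | hz
  · rw [← hz] at t1 ⊢
    have e0 : (0 : ℝ) ^ 2 = 0 := by norm_num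
    simp only [e0, zero_mul, mul_zero, zero_add]
    linarith only [t2, hK0, ha]
  have hXc : X ≤ c := by
    by_contra hneg
    have : ζ = 0 := max_eq_left (by linarith only [hneg])
    linarith only [this, hz]
  have b1 : (k / 2) * (S + 4 * T) / σ ^ 2 ≤ 2 * H * c / σ :=
    twist_term_le hS hT hH hc0 hXc hk
  have b2 : (r - 4 * a * S) / σ ^ 2 - 2 * (S + 4 * T) * (r - a * S) / σ ^ 3 ≤
      a * S * (4 * T - 2 * S) / σ ^ 3 :=
    rotation_term_le hS hT hr
  have b3 : -(K * ((φ + β / 2) / σ - (2 * M + γ - 4 * X * S) / σ ^ 2)) ≤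
      12 * a - 6 * a * T / σ ^ 2 + c * (K * (H * (1 + h)) + K * (H * (1 + h / 2))) / σ :=
    radial_term_le hg hK0 hK ha hc0 hc1 hh hH hS hT hX0 hXc hM hφ' hγ hβ
  have b4 : a * S * (4 * T - 2 * S) / σ ^ 3 - 6 * a * T / σ ^ 2 ≤ -a / σ :=
    main_term_le ha hS hT
  have hMh : 2 * M ≤ h * σ :=
    hM.trans (by
      calc φ * S ≤ h * S := by gcongr
        _ ≤ h * σ := by gcongr)
  have b5 : 2 * (S * (S + 4 * T) ^ 2 / σ ^ 4) + 2 * (K ^ 2 * M / σ ^ 2) ≤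
      2 * (16 + K ^ 2 * h) / σ :=
    drift_sq_le hS hT hh hMh
  set Q := 2 * (S * (S + 4 * T) ^ 2 / σ ^ 4) + 2 * (K ^ 2 * M / σ ^ 2) with hQ
  have b6 : ε * (2 * (ζ ^ 2) ^ 2 * Q) ≤ ζ ^ 2 * (a / 2 / σ) := by
    have hle : ζ ^ 2 ≤ 1 := pow_le_one₀ hζ0 hζ1
    have h1 : ε * (2 * (ζ ^ 2) ^ 2 * Q) ≤ ε * (2 * (ζ ^ 2) ^ 2 * (2 * (16 + K ^ 2 * h) / σ)) := by
      gcongr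
    have h2 : ε * (2 * (ζ ^ 2) ^ 2 * (2 * (16 + K ^ 2 * h) / σ)) =
        ζ ^ 2 * (ζ ^ 2 * (ε * (4 * (16 + K ^ 2 * h)) / σ)) := by ring
    rw [h2] at h1
    refine h1.trans ?_
    gcongr
    calc ζ ^ 2 * (ε * (4 * (16 + K ^ 2 * h)) / σ) ≤ 1 * (ε * (4 * (16 + K ^ 2 * h)) / σ) := by
          gcongr
      _ ≤ a / 2 / σ := by rw [one_mul]; gcongr
  set Bk := (k / 2) * (S + 4 * T) / σ ^ 2 + (r - 4 * a * S) / σ ^ 2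
        - 2 * (S + 4 * T) * (r - a * S) / σ ^ 3
        - K * ((φ + β / 2) / σ - (2 * M + γ - 4 * X * S) / σ ^ 2) with hBk
  have b7 : Bk ≤ 12 * a - a / 2 / σ := by
    have h1 : 2 * H * c / σ + c * (K * (H * (1 + h)) + K * (H * (1 + h / 2))) / σ ≤ a / 2 / σ := by
      rw [← add_div]
      gcongr
      linarith
    have h2 : -a / σ + a / 2 / σ = -(a / 2 / σ) := by ring
    rw [hBk, add_sub_assoc, sub_eq_add_neg]
    refine (add_le_add (add_le_add b1 b2) b3).trans ?_
    linarith only [h1, h2, b4]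
  have b8 : ζ ^ 2 * Bk ≤ ζ ^ 2 * (12 * a - a / 2 / σ) := by gcongr
  have b9 : ζ ^ 2 * (12 * a) ≤ 12 * a := by
    have hle : ζ ^ 2 ≤ 1 := pow_le_one₀ hζ0 hζ1
    nlinarith
  have e10 : ζ ^ 2 * (12 * a - a / 2 / σ) = ζ ^ 2 * (12 * a) - ζ ^ 2 * (a / 2 / σ) := by ring
  rw [mul_add]
  linarith only [t1, t2, b6, b8, b9, e10]

/-- The scale-free form of the boundary estimate. -/
theorem scalar_boundary_ge {a K c S T X : ℝ} (ha : 0 < a) (hK : 0 < K) (hc : 0 < c)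
    (hcK : 4 * K * c ≤ a / 2) (hS : 0 ≤ S) (hT : 0 < T) (hX : 0 ≤ X) :
    c ^ 2 * min (a / 8) 1 * (S / (S + T)) ≤
      max 0 (c - X) ^ 2 * (a * S * (S + 4 * T) / (S + T) ^ 2 - 4 * K * X * S / (S + T)) +
        4 * X ^ 2 := by
  set σ := S + T with hσ
  have hσ0 : 0 < σ := by positivity
  have hq0 : 0 ≤ S / σ := by positivity
  have hq1 : S / σ ≤ 1 := (div_le_one hσ0).2 (by linarith)
  have h1 : (S / σ) * (a - 4 * K * X) ≤
      a * S * (S + 4 * T) / σ ^ 2 - 4 * K * X * S / σ := by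
    have e : a * S * (S + 4 * T) / σ ^ 2 - 4 * K * X * S / σ =
        (S / σ) * (a - 4 * K * X) + (S / σ) * (a * (3 * T) / σ) := by
      rw [hσ]; field_simp; ring
    rw [e]
    have : 0 ≤ (S / σ) * (a * (3 * T) / σ) := by positivity
    linarith
  rcases le_or_gt X (c / 2) with hX2 | hX2
  · have h2 : a / 2 ≤ a - 4 * K * X := by nlinarith
    have h3 : c / 2 ≤ max 0 (c - X) := le_max_of_le_right (by linarith)
    have h4 : (c / 2) ^ 2 * ((S / σ) * (a / 2)) ≤
        max 0 (c - X) ^ 2 * (a * S * (S + 4 * T) / σ ^ 2 - 4 * K * X * S / σ) := by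
      have h5 : (S / σ) * (a / 2) ≤ a * S * (S + 4 * T) / σ ^ 2 - 4 * K * X * S / σ :=
        le_trans (by gcongr) h1
      gcongr
    have h6 : c ^ 2 * min (a / 8) 1 * (S / σ) ≤ c ^ 2 * (a / 8) * (S / σ) := by
      gcongr; exact min_le_left _ _
    nlinarith [sq_nonneg X]
  · have h6 : c ^ 2 * min (a / 8) 1 * (S / σ) ≤ c ^ 2 * 1 * 1 := by
      gcongr; exact min_le_right _ _
    have h7 : c ^ 2 ≤ 4 * X ^ 2 := by nlinarith
    have h8 : 0 ≤ max 0 (c - X) ^ 2 *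
        (a * S * (S + 4 * T) / σ ^ 2 - 4 * K * X * S / σ) := by
      rcases le_or_gt X c with hXc | hXc
      · have : 0 ≤ (S / σ) * (a - 4 * K * X) := by
          refine mul_nonneg hq0 ?_
          nlinarith
        have := this.trans h1
        positivity
      · rw [max_eq_left (by linarith)]; simp
    linarith

end ScalarEstimates

namespace StepTwoCarnot

section Drift

open Filter Topology
open scoped Matrix

variable {n m : ℕ} (G : StepTwoCarnot n m) (a c K R : ℝ)

noncomputable def den (p : Space n m) : ℝ := G.rotSq p + R * (R ^ 2 - gaugeFour a p)

noncomputable def num (p : Space n m) : ℝ := G.rotSq p + 4 * (R * (R ^ 2 - gaugeFour a p))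

/-- The `i`-th component of the horizontal vector field on `{N⁴ < R²}` that is used as a
multiplier. -/
noncomputable def drift (i : Fin n) (p : Space n m) : ℝ :=
  max 0 (c - horSq p / R) ^ 2 *
    (R * (G.rot p i * G.num a R p / G.den a R p ^ 2) - K * (G.rot2 p i / G.den a R p)) +
  p.1 i / R

/-- `X_i` applied to the `i`-th component of the drift. -/
noncomputable def dDrift (i : Fin n) (p : Space n m) : ℝ :=
  -2 * max 0 (c - horSq p / R) * (2 * p.1 i / R) *
    (R * (G.rot p i * G.num a R p / G.den a R p ^ 2) - K * (G.rot2 p i / G.den a R p)) +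
  max 0 (c - horSq p / R) ^ 2 *
    (R * (G.dRot i i p * G.num a R p / G.den a R p ^ 2 +
        G.rot p i * (G.dRotSq i p - 4 * R * G.dGaugeFour a i p) / G.den a R p ^ 2 -
        2 * G.rot p i * G.num a R p * (G.dRotSq i p - R * G.dGaugeFour a i p) / G.den a R p ^ 3) -
      K * (G.dRot2 i i p / G.den a R p -
        G.rot2 p i * (G.dRotSq i p - R * G.dGaugeFour a i p) / G.den a R p ^ 2)) +
  1 / R

variable (p : Space n m) {a R p}

theorem hasLineDerivAt_drift (i : Fin n) (hd : G.den a R p ≠ 0) :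
    HasLineDerivAt ℝ (G.drift a c K R i) (G.dDrift a c K R i p) p (G.field i p) := by
  have hconst : ∀ C : ℝ, HasLineDerivAt ℝ (fun _ : Space n m => C) 0 p (G.field i p) :=
    fun C => hasDerivAt_const _ _
  have hτ := hasLineDerivAt_const_mul R
    (hasLineDerivAt_sub (hconst (R ^ 2)) (G.hasLineDerivAt_gaugeFour a p i))
  have hden : HasLineDerivAt ℝ (G.den a R) _ p (G.field i p) :=
    hasLineDerivAt_add (G.hasLineDerivAt_rotSq p i) hτ
  have hnum : HasLineDerivAt ℝ (G.num a R) _ p (G.field i p) :=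
    hasLineDerivAt_add (G.hasLineDerivAt_rotSq p i) (hasLineDerivAt_const_mul 4 hτ)
  have hden2 := hasLineDerivAt_mul hden hden
  have h1 := hasLineDerivAt_const_mul R (hasLineDerivAt_div
    (hasLineDerivAt_mul (G.hasLineDerivAt_rot p i i) hnum) hden2 (mul_ne_zero hd hd))
  have h2 := hasLineDerivAt_const_mul K (hasLineDerivAt_div (G.hasLineDerivAt_rot2 p i i) hden hd)
  have hX := hasLineDerivAt_const_mul R⁻¹ (G.hasLineDerivAt_horSq p i)
  have hcut := hasLineDerivAt_comp (f := fun q => R⁻¹ * horSq q)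
    (hasDerivAt_sq_max_zero c (R⁻¹ * horSq p)) hX
  have h3 := hasLineDerivAt_const_mul R⁻¹ (G.hasLineDerivAt_fst p i i)
  have := hasLineDerivAt_add (hasLineDerivAt_mul hcut (hasLineDerivAt_sub h1 h2)) h3
  convert this using 1
  · funext q
    simp only [drift, div_eq_inv_mul, sq]
  · simp only [dDrift, if_true, div_eq_inv_mul]
    field_simp
    ring

theorem sum_dDrift :
    ∑ i, G.dDrift a c K R i p =
      4 * K * max 0 (c - horSq p / R) * (G.rotSq p / G.den a R p) / R +
      max 0 (c - horSq p / R) ^ 2 *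
        (R * ((1 / 2) * G.twistSq p * G.num a R p / G.den a R p ^ 2 +
            (∑ k, (G.twist k p ⬝ᵥ G.rot p) ^ 2 - 4 * R * (a * G.rotSq p)) / G.den a R p ^ 2 -
            2 * G.num a R p * (∑ k, (G.twist k p ⬝ᵥ G.rot p) ^ 2 - R * (a * G.rotSq p)) /
              G.den a R p ^ 3) -
          K * ((G.frobSq p + (1 / 2) * ∑ k, G.twist k p ⬝ᵥ (G.Λ k)ᵀ *ᵥ G.rot p) / G.den a R p -
            (2 * (G.rot2 p ⬝ᵥ G.rot2 p) +
              ∑ k, (G.twist k p ⬝ᵥ G.rot2 p) * (G.twist k p ⬝ᵥ G.rot p) -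
              R * (4 * horSq p * G.rotSq p)) / G.den a R p ^ 2)) +
      n / R := by
  set ζ := max 0 (c - horSq p / R)
  set W := G.num a R p
  set σ := G.den a R p
  have e : ∀ i, G.dDrift a c K R i p =
      -4 * ζ / R * (R * (W / σ ^ 2)) * (p.1 i * G.rot p i) +
      4 * K * ζ / R / σ * (p.1 i * G.rot2 p i) +
      ζ ^ 2 * R * (W / σ ^ 2) * G.dRot i i p +
      ζ ^ 2 * R * (1 / σ ^ 2 - 2 * W / σ ^ 3) * (G.rot p i * G.dRotSq i p) +
      ζ ^ 2 * R * (2 * R * W / σ ^ 3 - 4 * R / σ ^ 2) * (G.rot p i * G.dGaugeFour a i p) +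
      -(ζ ^ 2 * K / σ) * G.dRot2 i i p +
      ζ ^ 2 * K / σ ^ 2 * (G.rot2 p i * G.dRotSq i p) +
      -(ζ ^ 2 * K * R / σ ^ 2) * (G.rot2 p i * G.dGaugeFour a i p) + 1 / R := fun i => by
    simp only [dDrift]
    ring
  simp only [e, Finset.sum_add_distrib, ← Finset.mul_sum, G.sum_dRot, G.sum_rot_mul_dRotSq,
    G.sum_rot_mul_dGaugeFour, G.sum_dRot2, G.sum_rot2_mul_dRotSq, G.sum_rot2_mul_dGaugeFour]
  rw [show ∑ i, p.1 i * G.rot p i = 0 from G.hor_dot_rot p,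
    show ∑ i, p.1 i * G.rot2 p i = G.rotSq p from G.hor_dot_rot2 p]
  simp only [Finset.sum_const, Finset.card_univ, Fintype.card_fin, nsmul_eq_mul]
  ring

theorem sum_drift_sq_le : ∑ i, G.drift a c K R i p ^ 2 ≤
    2 * (max 0 (c - horSq p / R) ^ 2) ^ 2 *
      (2 * (R ^ 2 * G.rotSq p * G.num a R p ^ 2 / G.den a R p ^ 4) +
        2 * (K ^ 2 * (G.rot2 p ⬝ᵥ G.rot2 p) / G.den a R p ^ 2)) + 2 * horSq p / R ^ 2 := by
  set ζ := max 0 (c - horSq p / R) ^ 2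
  set W := G.num a R p
  set σ := G.den a R p
  have e : 2 * ζ ^ 2 * (2 * (R ^ 2 * G.rotSq p * W ^ 2 / σ ^ 4) +
        2 * (K ^ 2 * (G.rot2 p ⬝ᵥ G.rot2 p) / σ ^ 2)) + 2 * horSq p / R ^ 2 =
      ∑ i, (2 * ζ ^ 2 * (2 * (R ^ 2 * W ^ 2 / σ ^ 4) * (G.rot p i * G.rot p i) +
        2 * (K ^ 2 / σ ^ 2) * (G.rot2 p i * G.rot2 p i)) + 2 / R ^ 2 * (p.1 i * p.1 i)) := by
    simp only [Finset.sum_add_distrib, ← Finset.mul_sum, rotSq, horSq, dotProduct]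
    ring
  rw [e]
  refine Finset.sum_le_sum fun i _ => ?_
  rw [drift]
  have sq2 : ∀ u v : ℝ, (u + v) ^ 2 ≤ 2 * u ^ 2 + 2 * v ^ 2 := fun u v => by
    nlinarith [sq_nonneg (u - v)]
  have sq2' : ∀ u v : ℝ, (u - v) ^ 2 ≤ 2 * u ^ 2 + 2 * v ^ 2 := fun u v => by
    nlinarith [sq_nonneg (u + v)]
  refine (sq2 _ _).trans ?_
  have h1 := sq2' (R * (G.rot p i * W / σ ^ 2)) (K * (G.rot2 p i / σ))
  rw [mul_pow]
  have h2 := mul_le_mul_of_nonneg_left h1 (sq_nonneg ζ)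
  refine le_trans (add_le_add_left (mul_le_mul_of_nonneg_left h2 zero_le_two) _) (le_of_eq ?_)
  ring

theorem sum_drift_mul_dGaugeFour : ∑ i, G.drift a c K R i p * G.dGaugeFour a i p =
    max 0 (c - horSq p / R) ^ 2 *
      (R * (a * G.rotSq p * G.num a R p / G.den a R p ^ 2) -
        K * (4 * horSq p * G.rotSq p / G.den a R p)) + 4 * horSq p ^ 2 / R := by
  set ζ := max 0 (c - horSq p / R) ^ 2 with hζ
  set W := G.num a R p with hW
  set σ := G.den a R p with hσ
  have e : ∀ i, G.drift a c K R i p * G.dGaugeFour a i p =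
      ζ * R * (W / σ ^ 2) * (G.rot p i * G.dGaugeFour a i p) +
      -(ζ * K / σ) * (G.rot2 p i * G.dGaugeFour a i p) +
      1 / R * (p.1 i * G.dGaugeFour a i p) := fun i => by
    simp only [drift, ← hζ, ← hW, ← hσ]
    ring
  simp only [e, Finset.sum_add_distrib, ← Finset.mul_sum, G.sum_rot_mul_dGaugeFour,
    G.sum_rot2_mul_dGaugeFour, G.sum_hor_mul_dGaugeFour]
  ring

theorem den_pos (hR : 0 < R) (h : gaugeFour a p < R ^ 2) : 0 < G.den a R p := by
  have := G.rotSq_nonneg p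
  have : 0 < R * (R ^ 2 - gaugeFour a p) := mul_pos hR (sub_pos.2 h)
  rw [den]; linarith

theorem divergence_drift_le {γ ε : ℝ} (ha : 0 < a) (hγ : 0 < γ)
    (hγp : γ * (p.2.ofLp ⬝ᵥ p.2.ofLp) ≤ G.frobSq p) (hK : K * (γ / a) = 12 * a)
    (hc0 : 0 < c) (hc1 : c ≤ 1 / 2) (hε : 0 ≤ ε)
    (hcC : c * (2 * G.totalSq + K * (G.totalSq * (1 + G.totalSq / a / 2)) +
      K * (G.totalSq * (1 + G.totalSq / a))) ≤ a / 2)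
    (hεC : ε * (4 * (16 + K ^ 2 * (G.totalSq / a))) ≤ a / 2)
    (hR : 0 < R) (h : gaugeFour a p < R ^ 2) :
    ∑ i, G.dDrift a c K R i p + ε * ∑ i, G.drift a c K R i p ^ 2 ≤
      (4 * K + 12 * a + n + 2 * ε) / R := by
  refine le_trans (add_le_add_right (mul_le_mul_of_nonneg_left
    (G.sum_drift_sq_le c K) hε) _) ?_
  rw [G.sum_dDrift]
  have hs0 := G.rotSq_nonneg p
  have hx0 := horSq_nonneg p
  have hH := G.totalSq_nonneg
  have hk := G.twistSq_le p
  have hk0 := G.twistSq_nonneg p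
  have hf := G.frobSq_le p
  have hf0 := G.frobSq_nonneg p
  have hsf := G.rotSq_le p
  have hM := G.two_mul_rot2_dot_self_le p
  have hγ' := G.sum_twist_dot_mul_le p hR
  have hβ' := G.neg_sum_twist_dot_le p hR
  have hr : 0 ≤ ∑ k, (G.twist k p ⬝ᵥ G.rot p) ^ 2 := Finset.sum_nonneg fun _ _ => sq_nonneg _
  have hz0 : 0 ≤ p.2.ofLp ⬝ᵥ p.2.ofLp := dotProduct_self_nonneg' _
  have hP : gaugeFour a p = horSq p ^ 2 + a * (p.2.ofLp ⬝ᵥ p.2.ofLp) := rfl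
  simp only [den, num]
  set τ := R ^ 2 - gaugeFour a p with hτ
  have hτ0 : 0 < τ := sub_pos.2 h
  set H := G.totalSq
  generalize G.rotSq p = s at *
  generalize horSq p = x at *
  generalize G.twistSq p = κ at *
  generalize G.frobSq p = F at *
  generalize G.rot2 p ⬝ᵥ G.rot2 p = μ at *
  generalize ∑ k, (G.twist k p ⬝ᵥ G.rot2 p) * (G.twist k p ⬝ᵥ G.rot p) = g2 at *
  generalize ∑ k, G.twist k p ⬝ᵥ (G.Λ k)ᵀ *ᵥ G.rot p = b2 at *
  generalize ∑ k, (G.twist k p ⬝ᵥ G.rot p) ^ 2 = r at *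
  generalize p.2.ofLp ⬝ᵥ p.2.ofLp = z at *
  generalize gaugeFour a p = P at *
  have hx2 : x ^ 2 ≤ R ^ 2 := by nlinarith
  have hxR : x ≤ R := abs_le_of_sq_le_sq' hx2 hR.le |>.2
  have hF : F ≤ H / a * R ^ 2 := by
    have : z ≤ R ^ 2 / a := by
      rw [le_div_iff₀ ha]; nlinarith
    calc F ≤ H * z := hf
      _ ≤ H * (R ^ 2 / a) := by gcongr
      _ = _ := by ring
  have hgF : γ / a * (R ^ 2 - x ^ 2 - τ) ≤ F := by
    refine le_trans (le_of_eq ?_) hγp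
    have : a * z = R ^ 2 - x ^ 2 - τ := by rw [hτ, hP]; ring
    rw [← this]; field_simp
  have hμ : μ ≤ H / a * R ^ 2 * s / 2 := by
    have : F * s ≤ H / a * R ^ 2 * s := by gcongr
    linarith
  have hsx : s ≤ H / a * R ^ 2 * x := hsf.trans (by gcongr)
  clear hf hsf hP hγp
  obtain ⟨S, rfl⟩ : ∃ S, s = R ^ 3 * S := ⟨s / R ^ 3, by field_simp⟩
  obtain ⟨T, hT⟩ : ∃ T, τ = R ^ 2 * T := ⟨τ / R ^ 2, by field_simp⟩
  rw [hT] at hτ0 hgF ⊢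
  obtain ⟨X, rfl⟩ : ∃ X, x = R * X := ⟨x / R, by field_simp⟩
  obtain ⟨k, rfl⟩ : ∃ k, κ = R * k := ⟨κ / R, by field_simp⟩
  obtain ⟨φ, rfl⟩ : ∃ φ, F = R ^ 2 * φ := ⟨F / R ^ 2, by field_simp⟩
  obtain ⟨M, rfl⟩ : ∃ M, μ = R ^ 5 * M := ⟨μ / R ^ 5, by field_simp⟩
  obtain ⟨g3, rfl⟩ : ∃ g3, g2 = R ^ 5 * g3 := ⟨g2 / R ^ 5, by field_simp⟩
  obtain ⟨β, rfl⟩ : ∃ β, b2 = R ^ 2 * β := ⟨b2 / R ^ 2, by field_simp⟩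
  obtain ⟨ρ, rfl⟩ : ∃ ρ, r = R ^ 4 * ρ := ⟨r / R ^ 4, by field_simp⟩
  have hS : 0 ≤ S := nonneg_of_mul_nonneg_right hs0 (by positivity)
  have hTp : 0 < T := pos_of_mul_pos_right hτ0 (by positivity)
  have hX0 : 0 ≤ X := nonneg_of_mul_nonneg_right hx0 hR
  have hX1 : X ≤ 1 := le_of_mul_le_mul_left (by linarith) hR
  have hkX : k ≤ H * X := le_of_mul_le_mul_left (by linarith) hR
  have hk0' : 0 ≤ k := nonneg_of_mul_nonneg_right hk0 hR
  have hρ : 0 ≤ ρ := nonneg_of_mul_nonneg_right hr (by positivity)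
  have hMφ : 2 * M ≤ φ * S :=
    le_of_mul_le_mul_left (by linarith) (show 0 < R ^ 5 by positivity)
  have hφ : φ ≤ H / a := le_of_mul_le_mul_left (by linarith) (show 0 < R ^ 2 by positivity)
  have hφ' : γ / a * (1 - X ^ 2 - T) ≤ φ :=
    le_of_mul_le_mul_left (by linarith) (show 0 < R ^ 2 by positivity)
  have hSX : S ≤ H / a * X :=
    le_of_mul_le_mul_left (by linarith) (show 0 < R ^ 3 by positivity)
  have hh : 0 ≤ H / a := by positivity
  have hMh : M ≤ H / a * S / 2 :=
    le_of_mul_le_mul_left (by linarith) (show 0 < R ^ 5 by positivity)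
  have hg3 : g3 ≤ H * (1 + H / a / 2) * X * S := by
    have e : R * k * (R ^ 5 * M / R + R * (R ^ 3 * S)) / 2 = R ^ 5 * (k * (M + S) / 2) := by
      field_simp
    rw [e] at hγ'
    have h1 : g3 ≤ k * (M + S) / 2 :=
      le_of_mul_le_mul_left hγ' (show 0 < R ^ 5 by positivity)
    have h2 : k * (M + S) ≤ (H * X) * (H / a * S / 2 + S) := by
      calc k * (M + S) ≤ k * (H / a * S / 2 + S) := by gcongr
        _ ≤ _ := by gcongr
    have h3 : (H * X) * (H / a * S / 2 + S) = H * (1 + H / a / 2) * X * S := by ring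
    have h4 : 0 ≤ H * (1 + H / a / 2) * X * S := by positivity
    linarith
  have hβX : -β ≤ H * (1 + H / a) * X := by
    have e : (R * (R * k) + H * (R ^ 3 * S) / R) / 2 = R ^ 2 * ((k + H * S) / 2) := by
      field_simp
    rw [e] at hβ'
    have h1 : -β ≤ (k + H * S) / 2 :=
      le_of_mul_le_mul_left (by linarith) (show 0 < R ^ 2 by positivity)
    have h2 : H * S ≤ H * (H / a * X) := by gcongr
    have h3 : 0 ≤ H * (1 + H / a) * X := by positivity
    have h4 : H * (1 + H / a) * X = H * X + H * (H / a * X) := by ring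
    linarith
  have key := scalar_divergence_le (N := n) ha (div_pos hγ ha) hK hc0 hc1 hε hh hH hcC hεC hS hTp
    hX0 hX1 hkX hρ hMφ hφ hφ' hg3 hβX
  rw [le_div_iff₀ hR]
  refine le_trans (le_of_eq ?_) key
  have eX : R * X / R = X := by field_simp
  rw [eX]
  have hσ : S + T ≠ 0 := by positivity
  have e1 : R ^ 3 * S + R * (R ^ 2 * T) = R ^ 3 * (S + T) := by ring
  have e2 : R ^ 3 * S + 4 * (R * (R ^ 2 * T)) = R ^ 3 * (S + 4 * T) := by ring
  rw [e1, e2]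
  generalize max 0 (c - X) = ζ
  generalize S + T = σ at *
  field_simp

theorem boundary_drift_ge (ha : 0 < a) (hK : 0 < K) (hc : 0 < c) (hcK : 4 * K * c ≤ a / 2)
    (hR : 0 < R) (h : gaugeFour a p < R ^ 2) :
    c ^ 2 * min (a / 8) 1 * R * (G.rotSq p / G.den a R p) ≤
      ∑ i, G.drift a c K R i p * G.dGaugeFour a i p := by
  rw [G.sum_drift_mul_dGaugeFour]
  have hs0 := G.rotSq_nonneg p
  have hx0 := horSq_nonneg p
  simp only [den, num]
  have hτ0 : 0 < R ^ 2 - gaugeFour a p := sub_pos.2 h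
  generalize R ^ 2 - gaugeFour a p = τ at *
  generalize G.rotSq p = s at *
  generalize horSq p = x at *
  obtain ⟨S, rfl⟩ : ∃ S, s = R ^ 3 * S := ⟨s / R ^ 3, by field_simp⟩
  obtain ⟨T, rfl⟩ : ∃ T, τ = R ^ 2 * T := ⟨τ / R ^ 2, by field_simp⟩
  obtain ⟨X, rfl⟩ : ∃ X, x = R * X := ⟨x / R, by field_simp⟩
  have hS : 0 ≤ S := nonneg_of_mul_nonneg_right hs0 (by positivity)
  have hTp : 0 < T := pos_of_mul_pos_right hτ0 (by positivity)
  have hX0 : 0 ≤ X := nonneg_of_mul_nonneg_right hx0 hR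
  have key := mul_le_mul_of_nonneg_left (scalar_boundary_ge ha hK hc hcK hS hTp hX0) hR.le
  have eX : R * X / R = X := by field_simp
  rw [eX]
  have hσ : S + T ≠ 0 := by positivity
  have e1 : R ^ 3 * S + R * (R ^ 2 * T) = R ^ 3 * (S + T) := by ring
  have e2 : R ^ 3 * S + 4 * (R * (R ^ 2 * T)) = R ^ 3 * (S + 4 * T) := by ring
  rw [e1, e2]
  generalize max 0 (c - X) = ζ at *
  generalize S + T = σ at *
  have el : c ^ 2 * min (a / 8) 1 * R * (R ^ 3 * S / (R ^ 3 * σ)) =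
    R * (c ^ 2 * min (a / 8) 1 * (S / σ)) := by field_simp
  rw [el]
  refine key.trans (le_of_eq ?_)
  field_simp

end Drift

end StepTwoCarnot

section MovingEndpoint

open Filter Topology Set

/-- Leibniz' rule with a moving lower endpoint. -/
theorem hasDerivAt_integral_moving {φ : ℝ → ℝ} {φ' V η : ℝ} {F F' : ℝ → ℝ → ℝ} (hη : 0 < η)
    (hφ : HasDerivAt φ φ' 0) (hV : φ 0 ≤ V)
    (hF : ContinuousOn (Function.uncurry F) (Icc (-η) η ×ˢ Icc (φ 0 - η) (V + η)))
    (hF' : ContinuousOn (Function.uncurry F') (Icc (-η) η ×ˢ Icc (φ 0 - η) (V + η)))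
    (hder : ∀ s ∈ Icc (-η) η, ∀ v ∈ Icc (φ 0 - η) (V + η),
      HasDerivAt (fun s => F s v) (F' s v) s) :
    HasDerivAt (fun s => ∫ v in φ s..V, F s v) (-(F 0 (φ 0) * φ') + ∫ v in φ 0..V, F' 0 v) 0 := by
  set m₀ := φ 0 with hm₀
  have h0 : (0 : ℝ) ∈ Icc (-η) η := ⟨by linarith, hη.le⟩
  have hsl : ∀ {H : ℝ → ℝ → ℝ}, ContinuousOn (Function.uncurry H)
      (Icc (-η) η ×ˢ Icc (m₀ - η) (V + η)) → ∀ s ∈ Icc (-η) η,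
      ContinuousOn (H s) (Icc (m₀ - η) (V + η)) := fun {H} hH s hs =>
    hH.comp (f := fun v => (s, v)) (by fun_prop) fun v hv => ⟨hs, hv⟩
  have hint : ∀ {H : ℝ → ℝ → ℝ}, ContinuousOn (Function.uncurry H)
      (Icc (-η) η ×ˢ Icc (m₀ - η) (V + η)) → ∀ s ∈ Icc (-η) η, ∀ u ∈ Icc (m₀ - η) (V + η),
      ∀ v ∈ Icc (m₀ - η) (V + η), IntervalIntegrable (H s) volume u v :=
    fun {H} hH s hs u hu v hv =>
      ((hsl hH s hs).mono (by
        intro x hx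
        exact (convex_Icc _ _).ordConnected.uIcc_subset hu hv hx)).intervalIntegrable
  have hm : m₀ ∈ Icc (m₀ - η) (V + η) := ⟨by linarith, by linarith⟩
  have hVm : V ∈ Icc (m₀ - η) (V + η) := ⟨by linarith, by linarith⟩
  obtain ⟨M, hM⟩ := (isCompact_Icc.prod isCompact_Icc).exists_bound_of_continuousOn hF'
  have hMb : ∀ s ∈ Icc (-η) η, ∀ v ∈ Icc (m₀ - η) (V + η), ‖F' s v‖ ≤ M :=
    fun s hs v hv => hM (s, v) ⟨hs, hv⟩
  have hnhds : ∀ᶠ s in 𝓝 (0 : ℝ), s ∈ Icc (-η) η := Icc_mem_nhds (by linarith) hη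
  have hφc : ∀ᶠ s in 𝓝 (0 : ℝ), φ s ∈ Icc (m₀ - η) (V + η) :=
    hφ.continuousAt.eventually (Icc_mem_nhds (by linarith) (by linarith))
  have hΙ : uIoc m₀ V ⊆ Icc (m₀ - η) (V + η) := by
    rw [uIoc_of_le hV]
    exact fun x hx => ⟨by linarith [hx.1], by linarith [hx.2]⟩
  have hI : HasDerivAt (fun s => ∫ v in m₀..V, F s v) (∫ v in m₀..V, F' 0 v) 0 := by
    refine (intervalIntegral.hasDerivAt_integral_of_dominated_loc_of_deriv_le
      (bound := fun _ => M) (Icc_mem_nhds (by linarith) hη : Icc (-η) η ∈ 𝓝 (0 : ℝ)) ?_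
      (hint hF 0 h0 _ hm _ hVm) ?_ ?_ intervalIntegrable_const ?_).2
    · filter_upwards [hnhds] with s hs
      exact ((hsl hF s hs).mono hΙ).aestronglyMeasurable measurableSet_uIoc
    · exact ((hsl hF' 0 h0).mono hΙ).aestronglyMeasurable measurableSet_uIoc
    · exact Eventually.of_forall fun v hv s hs => hMb s hs v (hΙ hv)
    · exact Eventually.of_forall fun v hv s hs => hder s hs v (hΙ hv)
  have hF0 : ContinuousAt (F 0) m₀ :=
    (hsl hF 0 h0).continuousAt (Icc_mem_nhds (by linarith) (by linarith))
  have hJ : HasDerivAt (fun s => ∫ v in m₀..φ s, F 0 v) (F 0 m₀ * φ') 0 := by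
    have h1 : HasDerivAt (fun u => ∫ v in m₀..u, F 0 v) (F 0 m₀) (φ 0) :=
      intervalIntegral.integral_hasDerivAt_right (hint hF 0 h0 _ hm _ hm)
        ((hsl hF 0 h0).stronglyMeasurableAtFilter_nhdsWithin measurableSet_Icc m₀ |>.filter_mono (by
          rw [nhdsWithin_eq_nhds.2 (Icc_mem_nhds (by linarith) (by linarith))])) hF0
    exact h1.comp (0 : ℝ) hφ
  have hK : HasDerivAt (fun s => ∫ v in m₀..φ s, (F s v - F 0 v)) 0 0 := by
    rw [hasDerivAt_iff_isLittleO_nhds_zero]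
    have e0 : ∫ v in m₀..φ 0, (F 0 v - F 0 v) = 0 := by simp
    simp only [zero_add, e0, smul_zero, sub_zero]
    have hlo : (fun s : ℝ => s * (φ s - m₀)) =o[𝓝 0] fun s => s := by
      have h1 : (fun s => φ s - m₀) =o[𝓝 0] fun _ => (1 : ℝ) := by
        rw [Asymptotics.isLittleO_one_iff]
        have := hφ.continuousAt.tendsto.sub_const m₀
        rwa [← hm₀, sub_self] at this
      simpa using (Asymptotics.isBigO_refl (fun s : ℝ => s) (𝓝 0)).mul_isLittleO h1
    refine Asymptotics.IsBigO.trans_isLittleO ?_ hlo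
    refine Asymptotics.IsBigO.of_bound M ?_
    filter_upwards [hnhds, hφc] with s hs hφs
    have hb : ∀ v ∈ uIoc m₀ (φ s), ‖F s v - F 0 v‖ ≤ M * |s| := by
      intro v hv
      have hv' : v ∈ Icc (m₀ - η) (V + η) :=
        (convex_Icc _ _).ordConnected.uIcc_subset hm hφs (uIoc_subset_uIcc hv)
      have := (convex_Icc (-η) η).norm_image_sub_le_of_norm_hasDerivWithin_le
        (f := fun s => F s v) (f' := fun s => F' s v) (C := M)
        (fun x hx => (hder x hx v hv').hasDerivWithinAt) (fun x hx => hMb x hx v hv') h0 hs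
      simpa using this
    have := intervalIntegral.norm_integral_le_of_norm_le_const hb
    rw [norm_mul, Real.norm_eq_abs s, Real.norm_eq_abs (φ s - m₀), ← mul_assoc]
    exact this
  have hsum := (hI.sub hJ).sub hK
  refine (hsum.congr_of_eventuallyEq ?_).congr_deriv (by ring)
  filter_upwards [hnhds, hφc] with s hs hφs
  simp only [Pi.sub_apply]
  rw [intervalIntegral.integral_sub (hint hF s hs _ hm _ hφs) (hint hF 0 h0 _ hm _ hφs)]
  rw [← intervalIntegral.integral_interval_sub_left (hint hF s hs _ hm _ hVm)
    (hint hF s hs _ hm _ hφs)]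
  ring

theorem integral_moving_eq {E : Type*} {P : E → ℝ} {k : ℝ → E → ℝ} {ω : ℝ → ℝ} {V : ℝ}
    (hω : ∀ v, V ≤ v → ω v = 0) (p : E) :
    ∫ v in P p..V, k v p * ω v = ∫ v in P p..V, k (max v (P p)) p * ω v := by
  refine intervalIntegral.integral_congr fun v hv => ?_
  rcases le_or_gt V v with h | h
  · simp [hω v h]
  · rcases le_total (P p) V with h' | h'
    · rw [uIcc_of_le h'] at hv
      rw [max_eq_left hv.1]
    · rw [uIcc_of_ge h'] at hv
      exact absurd hv.1 (not_le.2 h)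

theorem integral_moving_eq_zero {E : Type*} {P : E → ℝ} {k : ℝ → E → ℝ} {ω : ℝ → ℝ} {V₀ V : ℝ}
    (hV : V₀ ≤ V) (hω : ∀ v, V₀ ≤ v → ω v = 0) {p : E} (hp : V₀ ≤ P p) :
    ∫ v in P p..V, k v p * ω v = 0 := by
  refine intervalIntegral.integral_zero_ae (Eventually.of_forall fun v hv => ?_)
  have : min (P p) V ≤ v := by
    rw [uIoc] at hv; exact hv.1.le
  rw [hω v ((le_min hp hV).trans this), mul_zero]

theorem continuous_integral_moving {E : Type*} [TopologicalSpace E] {P : E → ℝ} {k : ℝ → E → ℝ} {ω : ℝ → ℝ} {V δ : ℝ} (hδ : 0 < δ)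
    (hP : Continuous P) (hω : Continuous ω) (hω0 : ∀ v, V ≤ v → ω v = 0)
    (hk : ContinuousOn (Function.uncurry k) {x | P x.2 < x.1 + δ}) :
    Continuous fun p => ∫ v in P p..V, k v p * ω v := by
  have e : (fun p => ∫ v in P p..V, k v p * ω v) =
      fun p => -∫ v in V..P p, k (max v (P p)) p * ω v :=
    funext fun p => (integral_moving_eq hω0 p).trans (intervalIntegral.integral_symm V (P p))
  rw [e]
  refine (intervalIntegral.continuous_parametric_intervalIntegral_of_continuous
    (f := fun p v => k (max v (P p)) p * ω v) ?_ hP).neg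
  have h1 : Continuous fun x : E × ℝ => k (max x.2 (P x.1)) x.1 :=
    hk.comp_continuous (f := fun x : E × ℝ => (max x.2 (P x.1), x.1)) (by fun_prop) fun x => by
      have := le_max_right x.2 (P x.1)
      simp only [mem_ofPred_eq]
      linarith
  exact h1.mul (hω.comp continuous_snd)

theorem hasLineDerivAt_integral_moving {E : Type*} [NormedAddCommGroup E] [NormedSpace ℝ E]
    {P : E → ℝ} {k k' : ℝ → E → ℝ} {ω : ℝ → ℝ} {V₀ V δ P' : ℝ}
    {p w : E} (hδ : 0 < δ) (hP : Continuous P) (hω : Continuous ω) (hV : V₀ < V)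
    (hω0 : ∀ v, V₀ ≤ v → ω v = 0)
    (hk : ContinuousOn (Function.uncurry k) {x | P x.2 < x.1 + δ})
    (hk' : ContinuousOn (Function.uncurry k') {x | P x.2 < x.1 + δ})
    (hPd : HasLineDerivAt ℝ P P' p w)
    (hd : ∀ v s : ℝ, P (p + s • w) < v + δ →
      HasDerivAt (fun s => k v (p + s • w)) (k' v (p + s • w)) s) :
    HasLineDerivAt ℝ (fun q => ∫ v in P q..V, k v q * ω v)
      (-(k (P p) p * ω (P p) * P') + ∫ v in P p..V, k' v p * ω v) p w := by
  rcases lt_or_ge V₀ (P p) with h | h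
  · rw [integral_moving_eq_zero hV.le hω0 h.le, hω0 _ h.le]
    simp only [mul_zero, zero_mul, neg_zero, add_zero]
    have hz : HasLineDerivAt ℝ (fun _ : E => (0 : ℝ)) 0 p w := hasDerivAt_const _ _
    refine hz.congr_of_eventuallyEq ?_
    filter_upwards [hP.continuousAt.eventually (lt_mem_nhds h)] with q hq
    exact integral_moving_eq_zero hV.le hω0 hq.le
  · have hlin : Continuous fun s : ℝ => p + s • w := by fun_prop
    have hev : ∀ᶠ s : ℝ in 𝓝 0, P (p + s • w) < P p + δ / 2 := by
      have : ContinuousAt (fun s : ℝ => P (p + s • w)) 0 := (hP.comp hlin).continuousAt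
      refine this.eventually (gt_mem_nhds ?_)
      simp [hδ]
    obtain ⟨r, hr, hball⟩ := Metric.eventually_nhds_iff.1 hev
    have hdom : ∀ s ∈ Icc (-(min (r / 2) (δ / 4))) (min (r / 2) (δ / 4)),
        ∀ v, P p - min (r / 2) (δ / 4) ≤ v → P (p + s • w) < v + δ := by
      intro s hs v hv
      have h1 : |s| ≤ min (r / 2) (δ / 4) := abs_le.2 hs
      have h2 := min_le_left (r / 2) (δ / 4)
      have h3 := min_le_right (r / 2) (δ / 4)
      have := hball (y := s) (by rw [Real.dist_eq, sub_zero]; linarith)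
      linarith
    have hη : 0 < min (r / 2) (δ / 4) := by positivity
    have hc : ∀ {k : ℝ → E → ℝ}, ContinuousOn (Function.uncurry k) {x | P x.2 < x.1 + δ} →
        ContinuousOn (Function.uncurry fun s v => k v (p + s • w) * ω v)
          (Icc (-(min (r / 2) (δ / 4))) (min (r / 2) (δ / 4)) ×ˢ
            Icc (P p - min (r / 2) (δ / 4)) (V + min (r / 2) (δ / 4))) := fun {k} hk => by
      refine ContinuousOn.mul (f := fun x : ℝ × ℝ => k x.2 (p + x.1 • w)) ?_ (by fun_prop)
      exact hk.comp (f := fun x : ℝ × ℝ => (x.2, p + x.1 • w)) (by fun_prop)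
        fun x hx => hdom x.1 hx.1 x.2 hx.2.1
    have e0 : P (p + (0 : ℝ) • w) = P p := by simp
    have key := hasDerivAt_integral_moving (V := V) (φ := fun s => P (p + s • w))
      (F := fun s v => k v (p + s • w) * ω v) (F' := fun s v => k' v (p + s • w) * ω v) hη hPd
      (by rw [e0]; linarith) (by rw [e0]; exact hc hk) (by rw [e0]; exact hc hk')
      (fun s hs v hv => (hd v s (hdom s hs v (by rw [e0] at hv; exact hv.1))).mul_const (ω v))
    simp only [zero_smul, add_zero] at key
    exact key

end MovingEndpoint

namespace StepTwoCarnot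

section Potential

open Filter Topology
open scoped Matrix

variable {n m : ℕ} (G : StepTwoCarnot n m) (a c K δ : ℝ)

theorem continuous_pencil (i j : Fin n) : Continuous fun p => G.pencil p i j := by
  simp only [pencil_apply]; fun_prop

theorem continuous_twist (k : Fin m) (i : Fin n) : Continuous fun p => G.twist k p i := by
  simp only [twist, Matrix.mulVec, dotProduct]; fun_prop

theorem continuous_rot (i : Fin n) : Continuous fun p => G.rot p i := by
  have := G.continuous_pencil
  simp only [rot, Matrix.mulVec, dotProduct]; fun_prop

theorem continuous_rot2 (i : Fin n) : Continuous fun p => G.rot2 p i := by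
  have h1 := G.continuous_pencil
  have h2 := G.continuous_rot
  simp only [rot2, Matrix.mulVec, dotProduct, Matrix.transpose_apply]; fun_prop

theorem continuous_rotSq : Continuous G.rotSq := by
  have h2 := G.continuous_rot
  unfold rotSq dotProduct; fun_prop

theorem continuous_horSq : Continuous (horSq : Space n m → ℝ) := by
  unfold horSq dotProduct; fun_prop

theorem continuous_gaugeFour : Continuous (gaugeFour a : Space n m → ℝ) := by
  have := continuous_horSq (n := n) (m := m)
  unfold gaugeFour dotProduct; fun_prop

theorem continuous_dRot (i j : Fin n) : Continuous (G.dRot i j) := by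
  have h1 := G.continuous_pencil
  have h2 := G.continuous_twist
  unfold dRot; fun_prop

theorem continuous_dRot2 (i j : Fin n) : Continuous (G.dRot2 i j) := by
  have h1 := G.continuous_pencil
  have h2 := G.continuous_twist
  have h3 := G.continuous_rot
  have h4 := G.continuous_dRot
  unfold dRot2; fun_prop

theorem continuous_dRotSq (i : Fin n) : Continuous (G.dRotSq i) := by
  have h2 := G.continuous_twist
  have h3 := G.continuous_rot
  have h4 := G.continuous_rot2
  unfold dRotSq dotProduct; fun_prop

theorem continuous_dGaugeFour (i : Fin n) : Continuous (G.dGaugeFour a i) := by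
  have h3 := G.continuous_rot
  have h4 := continuous_horSq (n := n) (m := m)
  unfold dGaugeFour; fun_prop

/-- The radius of the domain `{N⁴ < R²}`, regularised so that `{N⁴ ≤ v}` lies inside it. -/
noncomputable def rad (v : ℝ) : ℝ := √(|v| + δ)

variable {δ}

theorem rad_pos (hδ : 0 < δ) (v : ℝ) : 0 < rad δ v := Real.sqrt_pos.2 (by positivity)

theorem rad_sq (hδ : 0 < δ) (v : ℝ) : rad δ v ^ 2 = |v| + δ := Real.sq_sqrt (by positivity)

theorem continuous_rad : Continuous (rad δ) := by unfold rad; fun_prop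

variable {a}

theorem gaugeFour_nonneg (ha : 0 ≤ a) (p : Space n m) : 0 ≤ gaugeFour a p := by
  have : 0 ≤ p.2.ofLp ⬝ᵥ p.2.ofLp := dotProduct_self_nonneg' _
  unfold gaugeFour; positivity

theorem gaugeFour_lt_rad_sq (hδ : 0 < δ) {v : ℝ} {p : Space n m} (h : gaugeFour a p < v + δ) :
    gaugeFour a p < rad δ v ^ 2 := by
  rw [rad_sq hδ]
  linarith [le_abs_self v]

theorem continuousOn_drift (hδ : 0 < δ) (i : Fin n) :
    ContinuousOn (Function.uncurry fun v => G.drift a c K (rad δ v) i)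
      {x | gaugeFour a x.2 < x.1 + δ} := by
  intro x hx
  refine ContinuousAt.continuousWithinAt ?_
  have hR := (rad_pos hδ x.1).ne'
  have hd := (G.den_pos (rad_pos hδ x.1) (gaugeFour_lt_rad_sq hδ hx)).ne'
  have hd2 := pow_ne_zero 2 hd
  have c1 := G.continuous_rot
  have c2 := G.continuous_rot2
  have c3 := continuous_horSq (n := n) (m := m)
  have c4 : Continuous fun x : ℝ × Space n m => G.den a (rad δ x.1) x.2 := by
    have := G.continuous_rotSq
    have := continuous_gaugeFour (n := n) (m := m) a
    have := continuous_rad (δ := δ)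
    unfold den; fun_prop
  have c5 : Continuous fun x : ℝ × Space n m => G.num a (rad δ x.1) x.2 := by
    have := G.continuous_rotSq
    have := continuous_gaugeFour (n := n) (m := m) a
    have := continuous_rad (δ := δ)
    unfold num; fun_prop
  have c6 := continuous_rad (δ := δ)
  unfold Function.uncurry drift
  fun_prop (disch := assumption)

theorem continuousOn_dDrift (hδ : 0 < δ) (i : Fin n) :
    ContinuousOn (Function.uncurry fun v => G.dDrift a c K (rad δ v) i)
      {x | gaugeFour a x.2 < x.1 + δ} := by
  intro x hx
  refine ContinuousAt.continuousWithinAt ?_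
  have hR := (rad_pos hδ x.1).ne'
  have hd := (G.den_pos (rad_pos hδ x.1) (gaugeFour_lt_rad_sq hδ hx)).ne'
  have hd2 := pow_ne_zero 2 hd
  have hd3 := pow_ne_zero 3 hd
  have c1 := G.continuous_rot
  have c2 := G.continuous_rot2
  have c3 := continuous_horSq (n := n) (m := m)
  have c4 : Continuous fun x : ℝ × Space n m => G.den a (rad δ x.1) x.2 := by
    have := G.continuous_rotSq
    have := continuous_gaugeFour (n := n) (m := m) a
    have := continuous_rad (δ := δ)
    unfold den; fun_prop
  have c5 : Continuous fun x : ℝ × Space n m => G.num a (rad δ x.1) x.2 := by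
    have := G.continuous_rotSq
    have := continuous_gaugeFour (n := n) (m := m) a
    have := continuous_rad (δ := δ)
    unfold num; fun_prop
  have c6 := continuous_rad (δ := δ)
  have c7 := G.continuous_dRot
  have c8 := G.continuous_dRot2
  have c9 := G.continuous_dRotSq
  have c10 := G.continuous_dGaugeFour a
  unfold Function.uncurry dDrift
  fun_prop (disch := assumption)

variable (a δ)

/-- The superposition of the drifts over the domains `{N⁴ < v}`, with density `ω`. -/
noncomputable def potential (ω : ℝ → ℝ) (V : ℝ) (i : Fin n) (p : Space n m) : ℝ :=
  ∫ v in gaugeFour a p..V, G.drift a c K (rad δ v) i p * ω v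

noncomputable def dPotential (ω : ℝ → ℝ) (V : ℝ) (i : Fin n) (p : Space n m) : ℝ :=
  -(G.drift a c K (rad δ (gaugeFour a p)) i p * ω (gaugeFour a p) * G.dGaugeFour a i p) +
    ∫ v in gaugeFour a p..V, G.dDrift a c K (rad δ v) i p * ω v

variable {a δ} {ω : ℝ → ℝ} {V₀ V : ℝ}

theorem hasLineDerivAt_potential (hδ : 0 < δ) (hω : Continuous ω) (hV : V₀ < V)
    (hω0 : ∀ v, V₀ ≤ v → ω v = 0) (i : Fin n) (p : Space n m) :
    HasLineDerivAt ℝ (G.potential a c K δ ω V i) (G.dPotential a c K δ ω V i p) p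
      (G.field i p) := by
  refine hasLineDerivAt_integral_moving (k := fun v => G.drift a c K (rad δ v) i)
    (k' := fun v => G.dDrift a c K (rad δ v) i) hδ (continuous_gaugeFour a) hω hV hω0
    (G.continuousOn_drift c K hδ i) (G.continuousOn_dDrift c K hδ i)
    (G.hasLineDerivAt_gaugeFour a p i) fun v s hs => ?_
  have h := G.hasLineDerivAt_drift c K i
    (G.den_pos (rad_pos hδ v) (gaugeFour_lt_rad_sq hδ hs)).ne'
  rw [G.field_add_smul_field] at h
  have h1 : HasDerivAt (fun t : ℝ => G.drift a c K (rad δ v) i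
      (p + s • G.field i p + t • G.field i p))
      (G.dDrift a c K (rad δ v) i (p + s • G.field i p)) (s - s) := by
    rw [sub_self]; exact h
  have h2 := h1.comp_sub_const s s
  refine h2.congr_of_eventuallyEq (Eventually.of_forall fun t => ?_)
  simp only
  rw [add_assoc, ← add_smul, add_sub_cancel]

theorem continuous_potential (hδ : 0 < δ) (hω : Continuous ω) (hV : V₀ < V)
    (hω0 : ∀ v, V₀ ≤ v → ω v = 0) (i : Fin n) : Continuous (G.potential a c K δ ω V i) :=
  continuous_integral_moving (k := fun v => G.drift a c K (rad δ v) i) hδ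
    (continuous_gaugeFour a) hω (fun v hv => hω0 v (hV.le.trans hv))
    (G.continuousOn_drift c K hδ i)

theorem continuous_drift_boundary (hδ : 0 < δ) (i : Fin n) :
    Continuous fun p => G.drift a c K (rad δ (gaugeFour a p)) i p :=
  (G.continuousOn_drift c K hδ i).comp_continuous (f := fun p => (gaugeFour a p, p))
    (by have := continuous_gaugeFour (n := n) (m := m) a; fun_prop) fun p => by
      simp only [Set.mem_ofPred_eq]; linarith

theorem continuous_dPotential (hδ : 0 < δ) (hω : Continuous ω) (hV : V₀ < V)
    (hω0 : ∀ v, V₀ ≤ v → ω v = 0) (i : Fin n) : Continuous (G.dPotential a c K δ ω V i) :=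
  (((G.continuous_drift_boundary c K hδ i).mul (hω.comp (continuous_gaugeFour a))).mul
    (G.continuous_dGaugeFour a i)).neg.add
    (continuous_integral_moving (k := fun v => G.dDrift a c K (rad δ v) i) hδ
      (continuous_gaugeFour a) hω (fun v hv => hω0 v (hV.le.trans hv))
      (G.continuousOn_dDrift c K hδ i))

theorem potential_eq_zero (hV : V₀ < V) (hω0 : ∀ v, V₀ ≤ v → ω v = 0) (i : Fin n)
    {p : Space n m} (hp : V₀ ≤ gaugeFour a p) : G.potential a c K δ ω V i p = 0 :=
  integral_moving_eq_zero (k := fun v => G.drift a c K (rad δ v) i) hV.le hω0 hp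

theorem isCompact_gaugeFour_le (ha : 0 < a) (v : ℝ) :
    IsCompact {p : Space n m | gaugeFour a p ≤ v} := by
  refine Metric.isCompact_of_isClosed_isBounded
    (isClosed_le (continuous_gaugeFour a) continuous_const) ?_
  refine (Metric.isBounded_closedBall (x := (0 : Space n m)) (r := |v| + 1 + (|v| / a + 1))).subset
    fun p hp => ?_
  simp only [Set.mem_ofPred_eq] at hp
  have hx : horSq p = ‖p.1‖ ^ 2 := by
    rw [EuclideanSpace.real_norm_sq_eq]; simp [horSq, dotProduct, sq]
  have hz : p.2.ofLp ⬝ᵥ p.2.ofLp = ‖p.2‖ ^ 2 := by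
    rw [EuclideanSpace.real_norm_sq_eq]; simp [dotProduct, sq]
  rw [gaugeFour, hx, hz] at hp
  have hv := le_abs_self v
  have h1 : ‖p.1‖ ≤ |v| + 1 := by
    have h2 : (‖p.1‖ ^ 2) ^ 2 ≤ |v| := by nlinarith [mul_nonneg ha.le (sq_nonneg ‖p.2‖)]
    nlinarith [sq_nonneg (‖p.1‖ ^ 2 - 1), sq_nonneg (‖p.1‖ - 1), norm_nonneg p.1]
  have h2 : ‖p.2‖ ≤ |v| / a + 1 := by
    have h3 : ‖p.2‖ ^ 2 ≤ |v| / a := by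
      rw [le_div_iff₀ ha]; nlinarith [sq_nonneg (‖p.1‖ ^ 2)]
    nlinarith [sq_nonneg (‖p.2‖ - 1), norm_nonneg p.2]
  have h0 : 0 ≤ |v| / a := by positivity
  rw [mem_closedBall_zero_iff, Prod.norm_def]
  exact max_le (by linarith) (by linarith [abs_nonneg v])

theorem locLipAlong_of_hasLineDerivAt {A A' : Space n m → ℝ} {i : Fin n}
    (h : ∀ p, HasLineDerivAt ℝ A (A' p) p (G.field i p)) (hA' : Continuous A') :
    LocLipAlong (G.field i) A := by
  intro p
  have hev : ∀ᶠ q in 𝓝 p, |A' q| < |A' p| + 1 :=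
    (hA'.abs.continuousAt (x := p)).eventually (gt_mem_nhds (lt_add_one _))
  obtain ⟨r, hr, hball⟩ := Metric.eventually_nhds_iff_ball.1 hev
  refine ⟨|A' p| + 1, Metric.ball p r, Metric.ball_mem_nhds p hr, fun q hq s hs => ?_⟩
  have hd : ∀ t : ℝ, HasDerivAt (fun t : ℝ => A (q + t • G.field i q))
      (A' (q + t • G.field i q)) t := fun t => by
    have h0 := h (q + t • G.field i q)
    rw [G.field_add_smul_field] at h0
    have h1 : HasDerivAt (fun u : ℝ => A (q + t • G.field i q + u • G.field i q))
        (A' (q + t • G.field i q)) (t - t) := by rw [sub_self]; exact h0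
    refine (h1.comp_sub_const t t).congr_of_eventuallyEq (Eventually.of_forall fun u => ?_)
    simp only
    rw [add_assoc, ← add_smul, add_sub_cancel]
  have hseg : ∀ t ∈ Set.uIcc 0 s, q + t • G.field i q ∈ Metric.ball p r := by
    have hconv : Convex ℝ ((fun t : ℝ => q + t • G.field i q) ⁻¹' Metric.ball p r) := by
      have : (fun t : ℝ => q + t • G.field i q) =
          AffineMap.lineMap q (q + G.field i q) := by
        funext t; simp [AffineMap.lineMap_apply, add_comm]
      rw [this]
      exact (convex_ball p r).affine_preimage _
    exact fun t ht => hconv.ordConnected.uIcc_subset (by simpa using hq) hs ht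
  have := (convex_uIcc 0 s).norm_image_sub_le_of_norm_hasDerivWithin_le
    (f := fun t : ℝ => A (q + t • G.field i q)) (f' := fun t => A' (q + t • G.field i q))
    (C := |A' p| + 1) (fun t _ => (hd t).hasDerivWithinAt)
    (fun t ht => (hball _ (hseg t ht)).le) Set.left_mem_uIcc Set.right_mem_uIcc
  simpa using this

end Potential

end StepTwoCarnot

namespace StepTwoCarnot

section Multiplier

open Filter Topology
open scoped Matrix

variable {n m : ℕ} {G : StepTwoCarnot n m} {a c K δ q : ℝ} {f : Space n m → ℝ}

theorem norm_fst_sq (p : Space n m) : ‖p.1‖ ^ 2 = horSq p := by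
  rw [EuclideanSpace.real_norm_sq_eq]; simp [horSq, dotProduct, sq]

theorem norm_snd_sq (p : Space n m) : ‖p.2‖ ^ 2 = p.2.ofLp ⬝ᵥ p.2.ofLp := by
  rw [EuclideanSpace.real_norm_sq_eq]; simp [dotProduct, sq]

theorem gauge_eq (a : ℝ) (p : Space n m) : gauge a p = gaugeFour a p ^ ((1 : ℝ) / 4) := by
  rw [gauge, gaugeFour, ← norm_fst_sq, ← norm_snd_sq, ← pow_mul]

theorem continuous_gauge (a : ℝ) : Continuous (gauge a : Space n m → ℝ) := by
  rw [funext (gauge_eq a)]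
  exact (continuous_gaugeFour a).rpow_const fun _ => Or.inr (by norm_num)

theorem gauge_nonneg (ha : 0 ≤ a) (p : Space n m) : 0 ≤ gauge a p := by
  rw [gauge_eq]; exact Real.rpow_nonneg (gaugeFour_nonneg ha p) _

theorem gauge_pow_four (ha : 0 ≤ a) (p : Space n m) : gauge a p ^ 4 = gaugeFour a p := by
  rw [gauge_eq, ← Real.rpow_natCast, ← Real.rpow_mul (gaugeFour_nonneg ha p)]
  norm_num

theorem LocLipschitz.continuous (hf : G.LocLipschitz a f) : Continuous f := by
  rw [continuous_iff_continuousAt]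
  intro p
  obtain ⟨C, U, hU, hC⟩ := hf p
  have hop : Continuous fun v => gauge a (G.op (-p) v) := by
    refine (continuous_gauge a).comp ?_
    unfold op; fun_prop
  have h0 : gauge a (G.op (-p) p) = 0 := by
    have hz : G.op (-p) p = 0 := by
      ext j
      · simp [op]
      · have := Matrix.dotProduct_mulVec_self_of_skew (G.skew j) p.1.ofLp
        have e : ∑ i, (∑ l, G.Λ j i l * p.1 l) * p.1 i = 0 := by
          rw [← this]
          exact Finset.sum_congr rfl fun i _ => mul_comm _ _
        simp [op, e]
    rw [hz]
    simp [gauge]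
  have hlim : Tendsto (fun v => C * gauge a (G.op (-p) v)) (𝓝 p) (𝓝 0) := by
    have := (hop.tendsto p).const_mul C
    rwa [h0, mul_zero] at this
  rw [ContinuousAt, tendsto_iff_dist_tendsto_zero]
  refine squeeze_zero' (Eventually.of_forall fun _ => dist_nonneg) ?_ hlim
  filter_upwards [hU] with v hv
  rw [dist_comm, Real.dist_eq]
  exact hC p (mem_of_mem_nhds hU) v hv

theorem gauge_op_neg_add_smul_field (i : Fin n) (p : Space n m) (s : ℝ) :
    gauge a (G.op (-p) (p + s • G.field i p)) = |s| := by
  have e : G.op (-p) (p + s • G.field i p) = (EuclideanSpace.single i s, 0) := by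
    rw [← G.op_single]
    ext j
    · simp [op]
    · have := Matrix.dotProduct_mulVec_self_of_skew (G.skew j) p.1.ofLp
      have e : ∑ i, (∑ l, G.Λ j i l * p.1 l) * p.1 i = 0 := by
        rw [← this]
        exact Finset.sum_congr rfl fun i _ => mul_comm _ _
      simp [op, mul_add, Finset.sum_add_distrib, e]
  rw [e, gauge]
  simp only [PiLp.norm_single, norm_zero, Real.norm_eq_abs]
  rw [show |s| ^ 4 + a * 0 ^ 2 = |s| ^ 4 by ring, ← Real.rpow_natCast,
    ← Real.rpow_mul (abs_nonneg s)]
  norm_num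

theorem LocLipschitz.locLipAlong (hf : G.LocLipschitz a f) (i : Fin n) :
    LocLipAlong (G.field i) f := by
  intro p
  obtain ⟨C, U, hU, hC⟩ := hf p
  refine ⟨C, U, hU, fun q hq s hs => ?_⟩
  have := hC q hq _ hs
  rwa [gauge_op_neg_add_smul_field, abs_sub_comm] at this

theorem locallyLipschitz_abs_rpow (hq : 1 < q) : LocallyLipschitz fun x : ℝ => |x| ^ q := by
  have := contDiff_norm_rpow (E := ℝ) hq
  simp only [Real.norm_eq_abs] at this
  exact this.locallyLipschitz

theorem abs_rpow_sub_two_mul_sq (hq : 2 ≤ q) (x : ℝ) : |x| ^ (q - 2) * x ^ 2 = |x| ^ q := by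
  rcases eq_or_ne x 0 with rfl | hx
  · simp [Real.zero_rpow (show q ≠ 0 by linarith)]
  · rw [← sq_abs, ← Real.rpow_natCast, ← Real.rpow_add (abs_pos.2 hx)]
    norm_num

theorem rpow_sub_two_mul_sq_le (hq : 2 ≤ q) {x y : ℝ} (hx : 0 ≤ x) (hy : 0 ≤ y) :
    x ^ (q - 2) * y ^ 2 ≤ y ^ q + x ^ q := by
  have key : ∀ z : ℝ, 0 ≤ z → z ^ (q - 2) * z ^ 2 = z ^ q := fun z hz => by
    have := abs_rpow_sub_two_mul_sq hq z
    rwa [abs_of_nonneg hz] at this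
  rcases le_total x y with h | h
  · calc x ^ (q - 2) * y ^ 2 ≤ y ^ (q - 2) * y ^ 2 := by gcongr
      _ = y ^ q := key y hy
      _ ≤ _ := by linarith [Real.rpow_nonneg hx q]
  · calc x ^ (q - 2) * y ^ 2 ≤ x ^ (q - 2) * x ^ 2 := by gcongr
      _ = x ^ q := key x hx
      _ ≤ _ := by linarith [Real.rpow_nonneg hy q]

/-- Young's inequality for the first-order term. -/
theorem young_first_order (hq : 2 ≤ q) {ε : ℝ} (hε : 0 < ε) (φ : ℝ)
    (D : EuclideanSpace ℝ (Fin n)) (U : Fin n → ℝ) :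
    ∑ i, q * |φ| ^ (q - 2) * φ * D i * U i ≤
      ε * |φ| ^ q * ∑ i, U i ^ 2 + q ^ 2 / (4 * ε) * (‖D‖ ^ q + |φ| ^ q) := by
  have h1 : ∀ i, q * |φ| ^ (q - 2) * φ * D i * U i ≤
      ε * |φ| ^ q * U i ^ 2 + q ^ 2 / (4 * ε) * |φ| ^ (q - 2) * D i ^ 2 := by
    intro i
    have h2 : q * φ * D i * U i ≤ ε * φ ^ 2 * U i ^ 2 + q ^ 2 / (4 * ε) * D i ^ 2 := by
      have h3 : 0 ≤ (2 * ε * φ * U i - q * D i) ^ 2 / (4 * ε) := by positivity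
      have h4 : (2 * ε * φ * U i - q * D i) ^ 2 / (4 * ε) =
          ε * φ ^ 2 * U i ^ 2 + q ^ 2 / (4 * ε) * D i ^ 2 - q * φ * D i * U i := by
        field_simp; ring
      linarith
    have h5 : 0 ≤ |φ| ^ (q - 2) := Real.rpow_nonneg (abs_nonneg φ) _
    have h6 := mul_le_mul_of_nonneg_left h2 h5
    rw [← abs_rpow_sub_two_mul_sq hq φ]
    linarith
  refine (Finset.sum_le_sum fun i _ => h1 i).trans ?_
  rw [Finset.sum_add_distrib, ← Finset.mul_sum, ← Finset.mul_sum, ← EuclideanSpace.real_norm_sq_eq D]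
  have h7 := rpow_sub_two_mul_sq_le hq (abs_nonneg φ) (norm_nonneg D)
  have h8 : 0 ≤ q ^ 2 / (4 * ε) := by positivity
  have h9 := mul_le_mul_of_nonneg_left h7 h8
  linarith

theorem ofReal_integral_le_lintegral {α : Type*} [MeasurableSpace α] {μ : Measure α} {g : α → ℝ}
    (hg : Integrable g μ) : ENNReal.ofReal (∫ x, g x ∂μ) ≤ ∫⁻ x, ENNReal.ofReal (g x) ∂μ := by
  rw [integral_eq_lintegral_pos_part_sub_lintegral_neg_part hg]
  refine (ENNReal.ofReal_le_ofReal (sub_le_self _ ENNReal.toReal_nonneg)).trans ?_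
  exact ENNReal.ofReal_toReal_le

end Multiplier

end StepTwoCarnot

namespace StepTwoCarnot

section MultiplierInequality

open Filter Topology
open scoped Matrix

variable {n m : ℕ} (G : StepTwoCarnot n m) {a : ℝ}

theorem exists_drift_constants (ha : 0 < a) : ∃ c K ε D c₁ : ℝ, 0 < ε ∧ 0 ≤ D ∧ 0 < c₁ ∧
    (∀ R > 0, ∀ p : Space n m, gaugeFour a p < R ^ 2 →
      ∑ i, G.dDrift a c K R i p + ε * ∑ i, G.drift a c K R i p ^ 2 ≤ D / R) ∧
    ∀ R > 0, ∀ p : Space n m, gaugeFour a p < R ^ 2 →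
      c₁ * R * (G.rotSq p / G.den a R p) ≤ ∑ i, G.drift a c K R i p * G.dGaugeFour a i p := by
  obtain ⟨γ, hγ, hγp⟩ := G.exists_frobSq_ge
  have hH := G.totalSq_nonneg
  set H := G.totalSq
  set K := 12 * a / (γ / a) with hKdef
  have hK0 : 0 < K := by positivity
  have hK : K * (γ / a) = 12 * a := by rw [hKdef]; field_simp
  set B := 2 * H + K * (H * (1 + H / a / 2)) + K * (H * (1 + H / a)) with hB
  have hB0 : 0 ≤ B := by positivity
  set c := min (1 / 2) (a / 2 / (B + 4 * K)) with hc
  have hc0 : 0 < c := by positivity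
  have hcB : c * (B + 4 * K) ≤ a / 2 := by
    calc c * (B + 4 * K) ≤ a / 2 / (B + 4 * K) * (B + 4 * K) := by
          gcongr; exact min_le_right _ _
      _ = a / 2 := by field_simp
  have hc1 : c * B ≤ a / 2 := by nlinarith
  have hc2 : 4 * K * c ≤ a / 2 := by nlinarith
  set ε := a / 2 / (4 * (16 + K ^ 2 * (H / a))) with hε
  have hε0 : 0 < ε := by positivity
  have hεC : ε * (4 * (16 + K ^ 2 * (H / a))) ≤ a / 2 := by
    rw [hε, div_mul_cancel₀]; positivity
  refine ⟨c, K, ε, 4 * K + 12 * a + n + 2 * ε, c ^ 2 * min (a / 8) 1, hε0, by positivity,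
    by positivity, fun R hR p hp => ?_, fun R hR p hp => ?_⟩
  · exact G.divergence_drift_le c K ha hγ (hγp p) hK hc0 (min_le_left _ _) hε0.le hc1 hεC hR hp
  · exact G.boundary_drift_ge c K ha hK0 hc0 hc2 hR hp

variable {G} {c K ε D q δ V₀ V : ℝ} {ω E : ℝ → ℝ} {f : Space n m → ℝ}

theorem lineDeriv_abs_rpow_mul_potential (hq : 2 ≤ q) (hδ : 0 < δ) (hω : Continuous ω)
    (hV : V₀ < V) (hω0 : ∀ v, V₀ ≤ v → ω v = 0) {i : Fin n} {p : Space n m}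
    (hf : LineDifferentiableAt ℝ f p (G.field i p)) :
    lineDeriv ℝ (fun p => |f p| ^ q * G.potential a c K δ ω V i p) p (G.field i p) =
      q * |f p| ^ (q - 2) * f p * G.subgradient f p i * G.potential a c K δ ω V i p +
        |f p| ^ q * G.dPotential a c K δ ω V i p := by
  have h1 := hasLineDerivAt_comp (hasDerivAt_abs_rpow (f p) (show 1 < q by linarith))
    hf.hasLineDerivAt
  exact (hasLineDerivAt_mul h1 (G.hasLineDerivAt_potential c K hδ hω hV hω0 i p)).lineDeriv

theorem boundary_add_sum_lineDeriv_le (hε : 0 < ε) (hD : 0 ≤ D)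
    (hdiv : ∀ R > 0, ∀ p : Space n m, gaugeFour a p < R ^ 2 →
      ∑ i, G.dDrift a c K R i p + ε * ∑ i, G.drift a c K R i p ^ 2 ≤ D / R)
    (hq : 2 ≤ q) (hδ : 0 < δ) (hω : Continuous ω) (hω1 : ∀ v, 0 ≤ ω v)
    (hV : V₀ < V) (hω0 : ∀ v, V₀ ≤ v → ω v = 0) (hE0 : ∀ v, 0 ≤ E v)
    (hE : ∀ v, 1 ≤ v → v ≤ V → ∫ u in v..V, ω u ≤ E v) {p : Space n m}
    (hf : ∀ i, LineDifferentiableAt ℝ f p (G.field i p))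
    (hf0 : gaugeFour a p < 1 → f p = 0) :
    |f p| ^ q * (ω (gaugeFour a p) *
        ∑ i, G.drift a c K (rad δ (gaugeFour a p)) i p * G.dGaugeFour a i p) +
      ∑ i, lineDeriv ℝ (fun p => |f p| ^ q * G.potential a c K δ ω V i p) p (G.field i p) ≤
    (q ^ 2 / (4 * ε) * ‖G.subgradient f p‖ ^ q + (D + q ^ 2 / (4 * ε)) * |f p| ^ q) *
      E (gaugeFour a p) := by
  simp only [lineDeriv_abs_rpow_mul_potential hq hδ hω hV hω0 (hf _)]
  have hq0 : q ≠ 0 := by linarith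
  have hC0 : 0 ≤ q ^ 2 / (4 * ε) := by positivity
  have hG0 : 0 ≤ (q ^ 2 / (4 * ε) * ‖G.subgradient f p‖ ^ q +
      (D + q ^ 2 / (4 * ε)) * |f p| ^ q) := by positivity
  have hr0 : 0 ≤ (q ^ 2 / (4 * ε) * ‖G.subgradient f p‖ ^ q +
      (D + q ^ 2 / (4 * ε)) * |f p| ^ q) * E (gaugeFour a p) := mul_nonneg hG0 (hE0 _)
  by_cases hfp : f p = 0
  · simp only [hfp, abs_zero, Real.zero_rpow hq0, mul_zero, zero_mul, add_zero,
      Finset.sum_const_zero] at hr0 ⊢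
    exact hr0
  have hP1 : 1 ≤ gaugeFour a p := by
    by_contra hneg
    exact hfp (hf0 (not_le.1 hneg))
  set P := gaugeFour a p with hP
  rcases le_or_gt V₀ P with hPV | hPV
  · have h1 : ∀ i, G.potential a c K δ ω V i p = 0 := fun i =>
      G.potential_eq_zero c K hV hω0 i hPV
    have h2 : ∀ i, G.dPotential a c K δ ω V i p = 0 := fun i => by
      rw [dPotential, integral_moving_eq_zero (k := fun v => G.dDrift a c K (rad δ v) i) hV.le hω0
        hPV, hω0 _ hPV]
      simp
    simp only [h1, h2, hω0 _ hPV]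
    simpa using hr0
  have hPV' : P ≤ V := (hPV.trans hV).le
  have hmaps : ∀ v ∈ Set.uIcc P V, gaugeFour a p < v + δ := fun v hv => by
    rw [Set.uIcc_of_le hPV'] at hv
    linarith [hv.1]
  have hi : ∀ i, IntervalIntegrable (fun v => G.drift a c K (rad δ v) i p * ω v) volume P V :=
    fun i => ContinuousOn.intervalIntegrable <|
      ((G.continuousOn_drift c K hδ i).comp (f := fun v => (v, p)) (by fun_prop) hmaps).mul
        hω.continuousOn
  have hi' : ∀ i, IntervalIntegrable (fun v => G.dDrift a c K (rad δ v) i p * ω v) volume P V :=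
    fun i => ContinuousOn.intervalIntegrable <|
      ((G.continuousOn_dDrift c K hδ i).comp (f := fun v => (v, p)) (by fun_prop) hmaps).mul
        hω.continuousOn
  set X : Fin n → ℝ := fun i => q * |f p| ^ (q - 2) * f p * G.subgradient f p i with hX
  have key : |f p| ^ q * (ω P * ∑ i, G.drift a c K (rad δ P) i p * G.dGaugeFour a i p) +
      ∑ i, (X i * G.potential a c K δ ω V i p + |f p| ^ q * G.dPotential a c K δ ω V i p) =
      ∫ v in P..V, (∑ i, X i * G.drift a c K (rad δ v) i p +
        |f p| ^ q * ∑ i, G.dDrift a c K (rad δ v) i p) * ω v := by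
    have e1 : ∀ v, (∑ i, X i * G.drift a c K (rad δ v) i p +
        |f p| ^ q * ∑ i, G.dDrift a c K (rad δ v) i p) * ω v =
        ∑ i, (X i * (G.drift a c K (rad δ v) i p * ω v) +
          |f p| ^ q * (G.dDrift a c K (rad δ v) i p * ω v)) := fun v => by
      rw [Finset.mul_sum, ← Finset.sum_add_distrib, Finset.sum_mul]
      exact Finset.sum_congr rfl fun i _ => by ring
    simp only [e1]
    rw [intervalIntegral.integral_finsetSum fun i _ =>
      ((hi i).const_mul _).add ((hi' i).const_mul _)]
    rw [Finset.mul_sum, Finset.mul_sum, ← Finset.sum_add_distrib]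
    refine Finset.sum_congr rfl fun i _ => ?_
    rw [intervalIntegral.integral_add ((hi i).const_mul _) ((hi' i).const_mul _),
      intervalIntegral.integral_const_mul, intervalIntegral.integral_const_mul]
    simp only [potential, dPotential, ← hP]
    ring
  rw [key]
  have hbound : ∀ v ∈ Set.Icc P V, (∑ i, X i * G.drift a c K (rad δ v) i p +
        |f p| ^ q * ∑ i, G.dDrift a c K (rad δ v) i p) * ω v ≤
      (q ^ 2 / (4 * ε) * ‖G.subgradient f p‖ ^ q + (D + q ^ 2 / (4 * ε)) * |f p| ^ q) * ω v := by
    intro v hv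
    refine mul_le_mul_of_nonneg_right ?_ (hω1 v)
    have hR := rad_pos hδ v
    have hR1 : 1 ≤ rad δ v := by
      refine Real.one_le_sqrt.2 ?_
      linarith [le_abs_self v, hv.1]
    have h1 := hdiv _ hR p (gaugeFour_lt_rad_sq hδ (hmaps v (by
      rw [Set.uIcc_of_le hPV']; exact hv)))
    have h2 : D / rad δ v ≤ D := div_le_self hD hR1
    have h3 := young_first_order hq hε (f p) (G.subgradient f p)
      fun i => G.drift a c K (rad δ v) i p
    have hf0 : 0 ≤ |f p| ^ q := by positivity
    have h4 := mul_le_mul_of_nonneg_left (h1.trans h2) hf0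
    linarith
  have hωi : IntervalIntegrable ω volume P V := hω.intervalIntegrable _ _
  calc _ ≤ ∫ v in P..V, (q ^ 2 / (4 * ε) * ‖G.subgradient f p‖ ^ q +
        (D + q ^ 2 / (4 * ε)) * |f p| ^ q) * ω v := by
        refine intervalIntegral.integral_mono_on hPV' ?_ (hωi.const_mul _) hbound
        refine ContinuousOn.intervalIntegrable (ContinuousOn.mul ?_ hω.continuousOn)
        have hc1 : ∀ i, ContinuousOn (fun v => G.drift a c K (rad δ v) i p) (Set.uIcc P V) :=
          fun i => (G.continuousOn_drift c K hδ i).comp (f := fun v => (v, p)) (by fun_prop) hmaps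
        have hc2 : ∀ i, ContinuousOn (fun v => G.dDrift a c K (rad δ v) i p) (Set.uIcc P V) :=
          fun i => (G.continuousOn_dDrift c K hδ i).comp (f := fun v => (v, p)) (by fun_prop) hmaps
        fun_prop
    _ ≤ _ := by
        rw [intervalIntegral.integral_const_mul]
        exact mul_le_mul_of_nonneg_left (hE P hP1 hPV') hG0

theorem lintegral_boundary_le (ha : 0 < a) (hε : 0 < ε) (hD : 0 ≤ D) {c₁ : ℝ}
    (hdiv : ∀ R > 0, ∀ p : Space n m, gaugeFour a p < R ^ 2 →
      ∑ i, G.dDrift a c K R i p + ε * ∑ i, G.drift a c K R i p ^ 2 ≤ D / R)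
    (hbd : ∀ R > 0, ∀ p : Space n m, gaugeFour a p < R ^ 2 →
      c₁ * R * (G.rotSq p / G.den a R p) ≤ ∑ i, G.drift a c K R i p * G.dGaugeFour a i p)
    (hc₁ : 0 < c₁)
    (hq : 2 ≤ q) (hδ : 0 < δ) (hω : Continuous ω) (hω1 : ∀ v, 0 ≤ ω v)
    (hV : V₀ < V) (hω0 : ∀ v, V₀ ≤ v → ω v = 0) (hE0 : ∀ v, 0 ≤ E v)
    (hE : ∀ v, 1 ≤ v → v ≤ V → ∫ u in v..V, ω u ≤ E v)
    (hf : G.LocLipschitz a f) (hf0 : ∀ p, gaugeFour a p < 1 → f p = 0) :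
    ∫⁻ p, ENNReal.ofReal (c₁ * rad δ (gaugeFour a p) *
        (G.rotSq p / G.den a (rad δ (gaugeFour a p)) p) * ω (gaugeFour a p) * |f p| ^ q) ≤
      ∫⁻ p, ENNReal.ofReal ((q ^ 2 / (4 * ε) * ‖G.subgradient f p‖ ^ q +
        (D + q ^ 2 / (4 * ε)) * |f p| ^ q) * E (gaugeFour a p)) := by
  have hfc := hf.continuous
  have hP := continuous_gaugeFour (n := n) (m := m) a
  have hq0 : q ≠ 0 := by linarith
  have hhc : Continuous fun p => |f p| ^ q := hfc.abs.rpow_const fun _ => Or.inr (by linarith)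
  have hsupp : ∀ {g : Space n m → ℝ}, (∀ p, V₀ ≤ gaugeFour a p → g p = 0) →
      HasCompactSupport g := fun {g} hg =>
    HasCompactSupport.intro (isCompact_gaugeFour_le ha V₀) fun p hp => hg p (by
      simp only [Set.mem_ofPred_eq, not_le] at hp; exact hp.le)
  set F : Space n m → ℝ := fun p => |f p| ^ q * (ω (gaugeFour a p) *
        ∑ i, G.drift a c K (rad δ (gaugeFour a p)) i p * G.dGaugeFour a i p) with hF
  have hFc : Continuous F := by
    have h1 := G.continuous_drift_boundary (a := a) c K hδ
    have h2 := G.continuous_dGaugeFour a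
    fun_prop
  have hFi : Integrable F := hFc.integrable_of_hasCompactSupport (hsupp fun p hp => by
    simp [hF, hω0 _ hp])
  have hlip : ∀ i, LocLipAlong (G.field i)
      fun p => |f p| ^ q * G.potential a c K δ ω V i p := fun i =>
    ((hf.locLipAlong i).comp hfc (locallyLipschitz_abs_rpow (by linarith))).mul
      (G.locLipAlong_of_hasLineDerivAt (G.hasLineDerivAt_potential c K hδ hω hV hω0 i)
        (G.continuous_dPotential c K hδ hω hV hω0 i)) hhc (G.continuous_potential c K hδ hω hV hω0 i)
  have hΦ := fun i => integral_lineDeriv_field (hlip i)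
    (hhc.mul (G.continuous_potential c K hδ hω hV hω0 i))
    (hsupp fun p hp => by simp [G.potential_eq_zero c K hV hω0 i hp])
  set Φ : Space n m → ℝ := fun p =>
    ∑ i, lineDeriv ℝ (fun p => |f p| ^ q * G.potential a c K δ ω V i p) p (G.field i p) with hΦd
  have hΦi : Integrable Φ := integrable_finsetSum _ fun i _ => (hΦ i).1
  have hΦ0 : ∫ p, Φ p = 0 := by
    rw [hΦd, integral_finsetSum _ fun i _ => (hΦ i).1]
    exact Finset.sum_eq_zero fun i _ => (hΦ i).2
  have hFl : ∀ p, c₁ * rad δ (gaugeFour a p) *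
        (G.rotSq p / G.den a (rad δ (gaugeFour a p)) p) * ω (gaugeFour a p) * |f p| ^ q ≤ F p := by
    intro p
    have h1 := hbd _ (rad_pos hδ (gaugeFour a p)) p
      (gaugeFour_lt_rad_sq hδ (by linarith))
    have h2 := mul_le_mul_of_nonneg_left h1 (hω1 (gaugeFour a p))
    have h3 : 0 ≤ |f p| ^ q := by positivity
    have h4 := mul_le_mul_of_nonneg_left h2 h3
    refine le_trans (le_of_eq ?_) h4
    ring
  have hF0 : ∀ p, 0 ≤ F p := fun p => le_trans (by
    have h1 := rad_pos hδ (gaugeFour a p)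
    have h2 := G.rotSq_nonneg p
    have h3 := G.den_pos (rad_pos hδ (gaugeFour a p))
      (gaugeFour_lt_rad_sq (p := p) (v := gaugeFour a p) hδ (by linarith))
    have h4 := hω1 (gaugeFour a p)
    positivity) (hFl p)
  calc _ ≤ ∫⁻ p, ENNReal.ofReal (F p) := lintegral_mono fun p => ENNReal.ofReal_le_ofReal (hFl p)
    _ = ENNReal.ofReal (∫ p, F p) :=
        (ofReal_integral_eq_lintegral_ofReal hFi (Eventually.of_forall hF0)).symm
    _ = ENNReal.ofReal (∫ p, (F p + Φ p)) := by
        rw [integral_add hFi hΦi, hΦ0, add_zero]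
    _ ≤ ∫⁻ p, ENNReal.ofReal (F p + Φ p) := ofReal_integral_le_lintegral (hFi.add hΦi)
    _ ≤ _ := by
        refine lintegral_mono_ae ?_
        filter_upwards [ae_all_iff.2 fun i => ae_lineDifferentiableAt_field (hf.locLipAlong i) hfc]
          with p hp
        exact ENNReal.ofReal_le_ofReal (boundary_add_sum_lineDeriv_le hε hD hdiv hq hδ hω hω1
          hV hω0 hE0 hE hp (hf0 p))

end MultiplierInequality

end StepTwoCarnot

section RadialDensity

open Filter Topology Set

variable {g : ℝ → ℝ}

/-- `-d/dv exp (-g (v ^ (1/4)))` for `v ≥ 1`, extended by a constant to `v ≤ 1`. -/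
noncomputable def radialDensity (g : ℝ → ℝ) (v : ℝ) : ℝ :=
  deriv g (max v 1 ^ ((1 : ℝ) / 4)) * Real.exp (-g (max v 1 ^ ((1 : ℝ) / 4))) /
    (4 * (max v 1 ^ ((1 : ℝ) / 4)) ^ 3)

theorem one_le_max_rpow (v : ℝ) : 1 ≤ max v 1 ^ ((1 : ℝ) / 4) :=
  Real.one_le_rpow (le_max_right _ _) (by norm_num)

theorem deriv_nonneg_of_monotoneOn_Ici (hg : MonotoneOn g (Ici 0)) {t : ℝ} (ht : 0 < t) :
    0 ≤ deriv g t := by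
  rw [← derivWithin_of_mem_nhds (Ici_mem_nhds ht)]
  exact hg.derivWithin_nonneg

theorem radialDensity_nonneg (hg : MonotoneOn g (Ici 0)) (v : ℝ) : 0 ≤ radialDensity g v := by
  have h1 := one_le_max_rpow v
  have h2 := deriv_nonneg_of_monotoneOn_Ici hg (lt_of_lt_of_le one_pos h1)
  unfold radialDensity
  positivity

theorem continuous_radialDensity (hg : ContinuousOn g (Ici 0))
    (hg' : ContinuousOn (deriv g) (Ici 1)) : Continuous (radialDensity g) := by
  have ht : Continuous fun v : ℝ => max v 1 ^ ((1 : ℝ) / 4) :=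
    (by fun_prop : Continuous fun v : ℝ => max v 1).rpow_const fun _ => Or.inr (by norm_num)
  have h1 : Continuous fun v : ℝ => deriv g (max v 1 ^ ((1 : ℝ) / 4)) :=
    hg'.comp_continuous ht one_le_max_rpow
  have h2 : Continuous fun v : ℝ => g (max v 1 ^ ((1 : ℝ) / 4)) :=
    hg.comp_continuous ht fun v => zero_le_one.trans (one_le_max_rpow v)
  unfold radialDensity
  refine (h1.mul (Real.continuous_exp.comp h2.neg)).div (by fun_prop) fun v => ?_
  have := one_le_max_rpow v
  positivity

theorem hasDerivAt_exp_neg_comp_rpow (hg : DifferentiableOn ℝ g (Ici 0)) {v : ℝ} (hv : 1 ≤ v) :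
    HasDerivAt (fun v => -Real.exp (-g (v ^ ((1 : ℝ) / 4)))) (radialDensity g v) v := by
  have hv0 : 0 < v := by linarith
  have ht : 0 < v ^ ((1 : ℝ) / 4) := by positivity
  have h1 : HasDerivAt g (deriv g (v ^ ((1 : ℝ) / 4))) (v ^ ((1 : ℝ) / 4)) :=
    (hg.differentiableAt (Ici_mem_nhds ht)).hasDerivAt
  have h2 : HasDerivAt (fun v : ℝ => v ^ ((1 : ℝ) / 4)) (1 / 4 * v ^ ((1 : ℝ) / 4 - 1)) v :=
    Real.hasDerivAt_rpow_const (Or.inl hv0.ne')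
  have h3 := ((h1.comp v h2).neg.exp).neg
  refine h3.congr_deriv ?_
  have e : v ^ ((1 : ℝ) / 4 - 1) = 1 / (v ^ ((1 : ℝ) / 4)) ^ 3 := by
    rw [← Real.rpow_natCast, ← Real.rpow_mul hv0.le, eq_div_iff (by positivity),
      ← Real.rpow_add hv0]
    norm_num
  rw [radialDensity, max_eq_left hv, e]
  simp only [Pi.neg_apply, Function.comp_apply]
  field_simp

theorem integral_radialDensity_le (hgm : MonotoneOn g (Ici 0)) (hg : DifferentiableOn ℝ g (Ici 0))
    (hg' : ContinuousOn (deriv g) (Ici 1)) {u V : ℝ} (hu : 1 ≤ u) (hV : u ≤ V) {χ : ℝ → ℝ}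
    (hχ : Continuous χ) (hχ1 : ∀ v, χ v ≤ 1) :
    ∫ v in u..V, radialDensity g v * χ v ≤ Real.exp (-g (u ^ ((1 : ℝ) / 4))) := by
  have hc := continuous_radialDensity hg.continuousOn hg'
  calc ∫ v in u..V, radialDensity g v * χ v ≤ ∫ v in u..V, radialDensity g v := by
        refine intervalIntegral.integral_mono_on hV ((hc.mul hχ).intervalIntegrable _ _)
          (hc.intervalIntegrable _ _) fun v _ => ?_
        exact mul_le_of_le_one_right (radialDensity_nonneg hgm v) (hχ1 v)
    _ = -Real.exp (-g (V ^ ((1 : ℝ) / 4))) - -Real.exp (-g (u ^ ((1 : ℝ) / 4))) := by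
        refine intervalIntegral.integral_eq_sub_of_hasDerivAt
          (f := fun v => -Real.exp (-g (v ^ ((1 : ℝ) / 4)))) (fun v hv => ?_)
          (hc.intervalIntegrable _ _)
        rw [uIcc_of_le hV] at hv
        exact hasDerivAt_exp_neg_comp_rpow hg (hu.trans hv.1)
    _ ≤ _ := by linarith [Real.exp_pos (-g (V ^ ((1 : ℝ) / 4)))]

end RadialDensity

namespace StepTwoCarnot

section UBound

open Filter Topology
open scoped Matrix

variable {n m : ℕ} (G : StepTwoCarnot n m) {a : ℝ}

theorem ae_rotSq_pos : ∀ᵐ p : Space n m, 0 < G.rotSq p := by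
  set k₀ : Fin m := ⟨0, G.pos⟩
  have hx : ∀ᵐ x : EuclideanSpace ℝ (Fin n), G.Λ k₀ *ᵥ x.ofLp ≠ 0 := by
    let T : EuclideanSpace ℝ (Fin n) →ₗ[ℝ] (Fin n → ℝ) :=
      { toFun := fun x => G.Λ k₀ *ᵥ x.ofLp
        map_add' := fun x y => by simp [Matrix.mulVec_add]
        map_smul' := fun r x => by simp [Matrix.mulVec_smul] }
    have hT : LinearMap.ker T ≠ ⊤ := by
      intro h
      have h0 : T = 0 := LinearMap.ker_eq_top.1 h
      refine G.indep.ne_zero k₀ ?_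
      ext i j
      have := congrFun (LinearMap.congr_fun h0 (EuclideanSpace.single j 1)) i
      simpa [T] using this
    rw [ae_iff]
    exact measure_mono_null (fun x hx => not_not.1 hx) (Measure.addHaar_submodule volume _ hT)
  have hs : MeasurableSet {p : Space n m | G.rotSq p = 0} :=
    (isClosed_eq G.continuous_rotSq continuous_const).measurableSet
  have hnull : volume {p : Space n m | G.rotSq p = 0} = 0 := by
    refine (Measure.measure_prod_null hs).2 ?_
    filter_upwards [hx] with x hx0
    let T : EuclideanSpace ℝ (Fin m) →ₗ[ℝ] (Fin n → ℝ) :=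
      { toFun := fun z => ∑ k, z k • (G.Λ k *ᵥ x.ofLp)
        map_add' := fun z w => by simp [add_smul, Finset.sum_add_distrib]
        map_smul' := fun r z => by simp [mul_smul, Finset.smul_sum] }
    have hT : LinearMap.ker T ≠ ⊤ := by
      intro h
      have h0 : T = 0 := LinearMap.ker_eq_top.1 h
      refine hx0 ?_
      have := LinearMap.congr_fun h0 (EuclideanSpace.single k₀ 1)
      simpa [T, Pi.single_apply] using this
    refine measure_mono_null (fun z hz => ?_) (Measure.addHaar_submodule volume _ hT)
    have hz0 : G.rot (x, z) = 0 := dotProduct_self_eq_zero.1 hz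
    change T z = 0
    rw [← hz0]
    funext i
    rw [rot_apply]
    simp [T, twist]
  have : ∀ᵐ p : Space n m, G.rotSq p ≠ 0 := by
    rw [ae_iff]
    simpa using hnull
  filter_upwards [this] with p hp
  exact lt_of_le_of_ne (G.rotSq_nonneg p) hp.symm

variable {g : ℝ → ℝ}

theorem continuous_comp_gauge (ha : 0 ≤ a) (hg : ContinuousOn g (Set.Ici 0)) :
    Continuous fun p : Space n m => g (gauge a p) :=
  hg.comp_continuous (continuous_gauge a) (gauge_nonneg ha)

theorem lintegral_gibbs (ha : 0 ≤ a) (hg : ContinuousOn g (Set.Ici 0)) (u : Space n m → ℝ) :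
    ∫⁻ p, ENNReal.ofReal (u p) ∂(gibbs n m a g) =
      ENNReal.ofReal (∫ p' : Space n m, Real.exp (-g (gauge a p')))⁻¹ *
        ∫⁻ p, ENNReal.ofReal (Real.exp (-g (gauge a p)) * u p) := by
  have hc := continuous_comp_gauge (n := n) (m := m) ha hg
  set Z := ∫ p' : Space n m, Real.exp (-g (gauge a p'))
  have hZ : 0 ≤ Z⁻¹ := inv_nonneg.2 (integral_nonneg fun _ => (Real.exp_pos _).le)
  have hm : Measurable fun p : Space n m => ENNReal.ofReal (Real.exp (-g (gauge a p)) / Z) :=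
    ((Real.continuous_exp.comp hc.neg).div_const Z).measurable.ennreal_ofReal
  rw [gibbs, lintegral_withDensity_eq_lintegral_mul_non_measurable _ hm (Eventually.of_forall fun _ => ENNReal.ofReal_lt_top),
    ← lintegral_const_mul' _ _ ENNReal.ofReal_ne_top]
  refine lintegral_congr fun p => ?_
  rw [Pi.mul_apply, ← ENNReal.ofReal_mul (by positivity), ← ENNReal.ofReal_mul hZ]
  congr 1
  ring

/-- The `U`-bound with respect to Lebesgue measure. -/
theorem exists_lintegral_le (ha : 0 < a) (hgm : MonotoneOn g (Set.Ici 0))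
    (hg : DifferentiableOn ℝ g (Set.Ici 0)) (hg' : ContinuousOn (deriv g) (Set.Ici 1)) {q : ℝ}
    (hq : 2 ≤ q) : ∃ c C D : ℝ, 0 < c ∧ 0 < C ∧ 0 < D ∧ ∀ f : Space n m → ℝ,
      G.LocLipschitz a f → (∀ p, gauge a p < 1 → f p = 0) →
      ∫⁻ p, ENNReal.ofReal (Real.exp (-g (gauge a p)) *
          (c * (deriv g (gauge a p) / gauge a p ^ 2 * |f p| ^ q))) ≤
        ∫⁻ p, ENNReal.ofReal (Real.exp (-g (gauge a p)) *
          (C * ‖G.subgradient f p‖ ^ q + D * |f p| ^ q)) := by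
  obtain ⟨c, K, ε, D, c₁, hε, hD, hc₁, hdiv, hbd⟩ := G.exists_drift_constants ha
  refine ⟨c₁ / 4, q ^ 2 / (4 * ε), D + q ^ 2 / (4 * ε), by positivity, by positivity,
    by positivity, fun f hf hf0 => ?_⟩
  have hq0 : q ≠ 0 := by linarith
  have hP0 := gaugeFour_nonneg (n := n) (m := m) ha.le
  have hgauge : ∀ p : Space n m, 1 ≤ gaugeFour a p ↔ 1 ≤ gauge a p := fun p => by
    rw [← gauge_pow_four ha.le, one_le_pow_iff_of_nonneg (gauge_nonneg ha.le p) four_ne_zero]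
  have hf0' : ∀ p, gaugeFour a p < 1 → f p = 0 := fun p hp => hf0 p (by
    by_contra hneg
    exact absurd ((hgauge p).2 (not_lt.1 hneg)) (not_le.2 hp))
  set χ : ℕ → ℝ → ℝ := fun j v => max 0 (min 1 (j - v)) with hχ
  set δ : ℕ → ℝ := fun j => 1 / ((j : ℝ) + 1) with hδ
  have hδ0 : ∀ j, 0 < δ j := fun j => by positivity
  have hχc : ∀ j, Continuous (χ j) := fun j => by fun_prop
  have hωc := continuous_radialDensity hg.continuousOn hg'
  have hE := fun p : Space n m => gauge_eq a p
  set Fj : ℕ → Space n m → ℝ := fun j p => c₁ * rad (δ j) (gaugeFour a p) *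
    (G.rotSq p / G.den a (rad (δ j) (gaugeFour a p)) p) *
      (radialDensity g (gaugeFour a p) * χ j (gaugeFour a p)) * |f p| ^ q with hFj
  have hle : ∀ j, ∫⁻ p, ENNReal.ofReal (Fj j p) ≤
      ∫⁻ p, ENNReal.ofReal (Real.exp (-g (gauge a p)) *
          (q ^ 2 / (4 * ε) * ‖G.subgradient f p‖ ^ q + (D + q ^ 2 / (4 * ε)) * |f p| ^ q)) := by
    intro j
    have := lintegral_boundary_le (V₀ := j) (V := j + 1)
      (ω := fun v => radialDensity g v * χ j v)
      (E := fun v => Real.exp (-g (v ^ ((1 : ℝ) / 4)))) ha hε hD hdiv hbd hc₁ hq (hδ0 j)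
      (hωc.mul (hχc j)) (fun v => mul_nonneg (radialDensity_nonneg hgm v) (le_max_left _ _))
      (lt_add_one _) (fun v hv => by
        have : χ j v = 0 := max_eq_left ((min_le_right _ _).trans (by linarith))
        rw [this, mul_zero]) (fun v => (Real.exp_pos _).le)
      (fun v hv hvV => integral_radialDensity_le hgm hg hg' hv hvV (hχc j)
        fun v => max_le zero_le_one (min_le_left _ _)) hf hf0'
    refine this.trans (le_of_eq (lintegral_congr fun p => ?_))
    rw [← hE, mul_comm]
  have hmeas : ∀ j, Measurable fun p => ENNReal.ofReal (Fj j p) := by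
    intro j
    have h1 := continuous_gaugeFour (n := n) (m := m) a
    have h2 := G.continuous_rotSq
    have h3 := continuous_rad (δ := δ j)
    have h4 : Continuous fun p => G.den a (rad (δ j) (gaugeFour a p)) p := by
      unfold den; fun_prop
    have h5 : ∀ p, G.den a (rad (δ j) (gaugeFour a p)) p ≠ 0 := fun p =>
      (G.den_pos (rad_pos (hδ0 j) (gaugeFour a p))
        (gaugeFour_lt_rad_sq (p := p) (v := gaugeFour a p) (hδ0 j) (by linarith [hδ0 j]))).ne'
    have h6 : Continuous fun p => |f p| ^ q :=
      hf.continuous.abs.rpow_const fun _ => Or.inr (by linarith)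
    have h7 := hχc j
    have h8 : Continuous fun p => G.rotSq p / G.den a (rad (δ j) (gaugeFour a p)) p :=
      h2.div h4 h5
    exact (Continuous.measurable (by fun_prop)).ennreal_ofReal
  have hδlim : Tendsto δ atTop (𝓝 0) := tendsto_one_div_add_atTop_nhds_zero_nat
  have hlim : ∀ᵐ p : Space n m, ENNReal.ofReal (Real.exp (-g (gauge a p)) *
      (c₁ / 4 * (deriv g (gauge a p) / gauge a p ^ 2 * |f p| ^ q))) ≤
      liminf (fun j => ENNReal.ofReal (Fj j p)) atTop := by
    filter_upwards [G.ae_rotSq_pos] with p hp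
    by_cases hfp : f p = 0
    · simp [hfp, Real.zero_rpow hq0]
    have hP1 : 1 ≤ gaugeFour a p := by
      by_contra hneg
      exact hfp (hf0' p (not_le.1 hneg))
    have hN1 := (hgauge p).1 hP1
    set P := gaugeFour a p with hP
    set N := gauge a p with hN
    have hP0p : 0 ≤ P := hP0 p
    have hPN : P = N ^ 4 := (gauge_pow_four ha.le p).symm
    have hradlim : Tendsto (fun j => rad (δ j) P) atTop (𝓝 (N ^ 2)) := by
      have h1 : Tendsto (fun j => √(|P| + δ j)) atTop (𝓝 (√(|P| + 0))) :=
        (Real.continuous_sqrt.tendsto _).comp (tendsto_const_nhds.add hδlim)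
      have h2 : √(|P| + 0) = N ^ 2 := by
        rw [add_zero, abs_of_nonneg hP0p, hPN, show N ^ 4 = (N ^ 2) ^ 2 by ring,
          Real.sqrt_sq (by positivity)]
      rwa [h2] at h1
    have hdenlim : Tendsto (fun j => G.den a (rad (δ j) P) p) atTop (𝓝 (G.rotSq p)) := by
      have h1 : Tendsto (fun j => G.rotSq p + rad (δ j) P * (rad (δ j) P ^ 2 - P)) atTop
          (𝓝 (G.rotSq p + N ^ 2 * ((N ^ 2) ^ 2 - P))) :=
        tendsto_const_nhds.add (hradlim.mul ((hradlim.pow 2).sub tendsto_const_nhds))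
      rw [hPN, show (N ^ 2) ^ 2 - N ^ 4 = 0 by ring, mul_zero, add_zero, ← hPN] at h1
      exact h1
    have hχlim : Tendsto (fun j => χ j P) atTop (𝓝 1) := by
      refine tendsto_const_nhds.congr' ?_
      filter_upwards [eventually_ge_atTop ⌈P + 1⌉₊] with j hj
      have : P + 1 ≤ j := Nat.ceil_le.1 hj
      simp only [hχ]
      rw [min_eq_left (by linarith), max_eq_right zero_le_one]
    have hFlim : Tendsto (fun j => Fj j p) atTop (𝓝 (c₁ * N ^ 2 * (G.rotSq p / G.rotSq p) *
        (radialDensity g P * 1) * |f p| ^ q)) :=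
      (((tendsto_const_nhds.mul hradlim).mul (tendsto_const_nhds.div hdenlim hp.ne')).mul
        (tendsto_const_nhds.mul hχlim)).mul tendsto_const_nhds
    have hliminf := ((ENNReal.continuous_ofReal.tendsto _).comp hFlim).liminf_eq
    simp only [Function.comp_def] at hliminf
    rw [hliminf]
    refine ENNReal.ofReal_le_ofReal ?_
    rw [div_self hp.ne', radialDensity, max_eq_left hP1, ← hE p, ← hN]
    have hg0 : 0 ≤ deriv g N := deriv_nonneg_of_monotoneOn_Ici hgm (by linarith)
    have hN0 : 0 < N := by linarith
    have e1 : Real.exp (-g N) * (c₁ / 4 * (deriv g N / N ^ 2 * |f p| ^ q)) =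
        Real.exp (-g N) * (c₁ / 4) * deriv g N * |f p| ^ q * (1 / N ^ 2) := by ring
    have e2 : c₁ * N ^ 2 * 1 * (deriv g N * Real.exp (-g N) / (4 * N ^ 3) * 1) * |f p| ^ q =
        Real.exp (-g N) * (c₁ / 4) * deriv g N * |f p| ^ q * (1 / N) := by
      field_simp
    rw [e1, e2]
    gcongr
    nlinarith
  calc _ ≤ ∫⁻ p, liminf (fun j => ENNReal.ofReal (Fj j p)) atTop := lintegral_mono_ae hlim
    _ ≤ liminf (fun j => ∫⁻ p, ENNReal.ofReal (Fj j p)) atTop := lintegral_liminf_le hmeas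
    _ ≤ _ := liminf_le_of_le (by isBoundedDefault) fun b hb => by
        obtain ⟨j, hj⟩ := hb.exists
        exact hj.trans (hle j)

end UBound

end StepTwoCarnot

theorem theorem1 {n m : ℕ} (G : StepTwoCarnot n m) (a : ℝ) (ha : 0 < a) (g : ℝ → ℝ)
    (hg_nonneg : ∀ t, 0 ≤ t → 0 ≤ g t)
    (hg_mono : MonotoneOn g (Set.Ici 0))
    (hg_diff : DifferentiableOn ℝ g (Set.Ici 0))
    (hg_diff' : DifferentiableOn ℝ (deriv g) (Set.Ici 1))
    (hg_growth : ∀ t, 1 ≤ t → derivWithin (deriv g) (Set.Ici 1) t ≤ deriv g t ^ 3 * t ^ 3)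
    (hμ : IsProbabilityMeasure (StepTwoCarnot.gibbs n m a g))
    (q : ℝ) (hq : 2 ≤ q) :
    ∃ C D : ℝ, 0 < C ∧ 0 < D ∧
      ∀ f : StepTwoCarnot.Space n m → ℝ,
        G.LocLipschitz a f →
        (∀ p, StepTwoCarnot.gauge a p < 1 → f p = 0) →
        ∫⁻ p, ENNReal.ofReal
            (deriv g (StepTwoCarnot.gauge a p) / StepTwoCarnot.gauge a p ^ 2 * |f p| ^ q)
            ∂(StepTwoCarnot.gibbs n m a g) ≤
          ENNReal.ofReal C *
              ∫⁻ p, ENNReal.ofReal (‖G.subgradient f p‖ ^ q) ∂(StepTwoCarnot.gibbs n m a g) +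
            ENNReal.ofReal D *
              ∫⁻ p, ENNReal.ofReal (|f p| ^ q) ∂(StepTwoCarnot.gibbs n m a g) := by
  obtain ⟨c, C, D, hc, hC, hD, h⟩ :=
    G.exists_lintegral_le ha hg_mono hg_diff hg_diff'.continuousOn hq
  refine ⟨C / c, D / c, by positivity, by positivity, fun f hf hf0 => ?_⟩
  simp only [StepTwoCarnot.lintegral_gibbs ha.le hg_diff.continuousOn]
  have hE := StepTwoCarnot.continuous_comp_gauge (n := n) (m := m) ha.le hg_diff.continuousOn
  set Z := ENNReal.ofReal (∫ p' : StepTwoCarnot.Space n m,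
    Real.exp (-g (StepTwoCarnot.gauge a p')))⁻¹
  have hfm : Continuous fun p => |f p| ^ q :=
    hf.continuous.abs.rpow_const fun _ => Or.inr (by linarith)
  have hscale : ∀ (r : ℝ) (hr : 0 ≤ r) (u : StepTwoCarnot.Space n m → ℝ),
      ENNReal.ofReal r *
        ∫⁻ p, ENNReal.ofReal (Real.exp (-g (StepTwoCarnot.gauge a p)) * u p) =
      ∫⁻ p, ENNReal.ofReal (Real.exp (-g (StepTwoCarnot.gauge a p)) * (r * u p)) := by
    intro r hr u
    rw [← lintegral_const_mul' _ _ ENNReal.ofReal_ne_top]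
    refine lintegral_congr fun p => ?_
    rw [← ENNReal.ofReal_mul hr]
    congr 1
    ring
  rw [mul_left_comm (ENNReal.ofReal (C / c)), mul_left_comm (ENNReal.ofReal (D / c)), ← mul_add,
    hscale (C / c) (by positivity), hscale (D / c) (by positivity)]
  refine mul_le_mul' le_rfl ?_
  have hm : Measurable fun p => ENNReal.ofReal (Real.exp (-g (StepTwoCarnot.gauge a p)) *
      (D / c * |f p| ^ q)) :=
    ((Real.continuous_exp.comp hE.neg).mul (hfm.const_mul _)).measurable.ennreal_ofReal
  rw [← lintegral_add_right _ hm]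
  have h1 := mul_le_mul_right (h f hf hf0) (ENNReal.ofReal c⁻¹)
  simp only [hscale c⁻¹ (by positivity)] at h1
  refine le_trans (le_of_eq (lintegral_congr fun p => ?_))
    (h1.trans (le_of_eq (lintegral_congr fun p => ?_)))
  · rw [inv_mul_cancel_left₀ hc.ne']
  · rw [← ENNReal.ofReal_add (by positivity) (by positivity)]
    congr 1
    ring
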